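/- Let $0<\alpha<1$, $\epsilon,\kappa>0$, $f=F'$ with $F(u)=\frac14(u^2-1)^2$, and let $\Omega\subset\mathbb R^2$ be either a bounded domain with homogeneous Neumann boundary conditions, or a rectangle $(0,L_1)\times(0,L_2)$ with periodic boundary conditions; $V$ denotes $H^1(\Omega)$, respectively $H^1_{\rm per}(\Omega)$. For $v\in L^2(\Omega)$, $(-\Delta)^{-1}v$ denotes the zero-mean weak solution $w\in V$ (if it exists) of $\langle\nabla w,\nabla\psi\rangle=\langle v,\psi\rangle$ for all $\psi\in V$, and $\|v\|_{-1}^2=\langle v,v\rangle_{-1}=\langle(-\Delta)^{-1}v,v\rangle$. **Mesh and FBDF2 formula.** Let $0=t_0<t_1<\dots<t_N<t_{N+1}$ (the level $t_{N+1}$ only serves to define $r_{N+1}$), $\tau_k=t_k-t_{k-1}$, $t_{k-1/2}=\frac12(t_k+t_{k-1})$, $r_1=0$, $r_k=\tau_k/\tau_{k-1}$ for $k\ge2$, $\triangledown_\tau v^k=v^k-v^{k-1}$, $\partial_\tau v^k=\triangledown_\tau v^k/\tau_k$, and $\omega_\beta(s)=s^{\beta-1}/\Gamma(\beta)$. For $1\le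 k\le n$ put $$a^{(n)}_{n-k}=\frac1{\tau_k}\int_{t_{k-1}}^{t_k}\omega_{1-\alpha}(t_n-s)\,ds,\qquad \eta^{(n)}_{n-k}=\frac2{\tau_k}\int_{t_{k-1}}^{t_k}\frac{s-t_{k-1/2}}{\tau_k}\,\omega_{1-\alpha}(t_n-s)\,ds .$$ Let $\Pi_{2,k}v$ be the quadratic interpolant of $v$ at $t_{k-1},t_k,t_{k+1}$. The FBDF2 formula is $(\partial_\tau^\alpha v)^1=a_0^{(1)}\triangledown_\tau v^1$ and, for $n\ge2$, $$(\partial_\tau^\alpha v)^n=\int_{t_{n-1}}^{t_n}\omega_{1-\alpha}(t_n-s)(\Pi_{2,n-1}v)'(s)\,ds+\sum_{k=1}^{n-1}\int_{t_{k-1}}^{t_k}\omega_{1-\alpha}(t_n-s)(\Pi_{2,k}v)'(s)\,ds .$$ **Scheme.** Let $\phi^0\in L^2(\Omega)$ and let $\phi^n,\mu^n\in V$ with $f(\phi^n)\in L^2(\Omega)$, $1\le n\le N$, be a weak solution of the implicit variable-step FBDF2 scheme for the time-fractional Cahn–Hilliard equation, $$(\partial_\tau^\alpha\phi)^n=\kappa\Delta\mu^n,\qquad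 \mu^n=f(\phi^n)-\epsilon^2\Delta\phi^n,\qquad 1\le n\le N,$$ that is, for all $\psi\in V$, $\langle(\partial_\tau^\alpha\phi)^n,\psi\rangle=-\kappa\langle\nabla\mu^n,\nabla\psi\rangle$ and $\langle\mu^n,\psi\rangle=\langle f(\phi^n),\psi\rangle+\epsilon^2\langle\nabla\phi^n,\nabla\psi\rangle$. **Modified energy.** Put $\hat a_0^{(1)}=a_0^{(1)}$ and, for $n\ge2$, $\hat a_0^{(n)}=\frac{1-\alpha}{2-\alpha}a_0^{(n)}+\frac{\eta_1^{(n)}}{r_n(1+r_n)}$, $\hat a_{n-1}^{(n)}=a_{n-1}^{(n)}-\frac{\eta_{n-1}^{(n)}}{1+r_2}$, and $\hat a_{n-k}^{(n)}=a_{n-k}^{(n)}-\frac{\eta_{n-k}^{(n)}}{1+r_{k+1}}+\frac{\eta_{n-k+1}^{(n)}}{r_k(1+r_k)}$ for $2\le k\le n-1$; let $A_0^{(n)}=2\hat a_0^{(n)}$ and $A_{n-k}^{(n)}=\hat a_{n-k}^{(n)}$ for $1\le k\le n-1$. With $E[u]=\frac{\epsilon^2}2\|\nabla u\|^2+\langle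 F(u),1\rangle$, define for $n\ge1$ $$\mathcal E_\alpha[\phi^n]=E[\phi^n]+\frac1\kappa\langle\mathcal G[\triangledown_\tau\phi^n],1\rangle_{-1},$$ where, for functions $w_1,\dots,w_n$, $$\langle\mathcal G[w_n],1\rangle_{-1}=\frac{\alpha\,r_{n+1}^{2-\alpha/2}}{2(1+r_{n+1})\tau_n^\alpha}\frac{\|w_n\|_{-1}^2}{\Gamma(3-\alpha)}+\frac12\sum_{j=1}^{n-1}\big(A^{(n)}_{n-j-1}-A^{(n)}_{n-j}\big)\Big\|\sum_{\ell=j+1}^nw_\ell\Big\|_{-1}^2+\frac12A^{(n)}_{n-1}\Big\|\sum_{\ell=1}^nw_\ell\Big\|_{-1}^2 .$$ **Assumptions.** Let $$R_*=\tfrac19\sqrt[3]{\tfrac12(189-81\sqrt5)}+\tfrac13\sqrt[3]{\tfrac12(7+3\sqrt5)}-\tfrac13\approx0.4753,$$ let $r^*(\alpha)$ be the unique positive root $z$ of $\frac1\alpha+(1+\frac1\alpha)z-z^{2-\alpha/2}=0$, and let $$g(x,y,\alpha)=\frac{2+2(1+\alpha)x-\alpha x^{2-\alpha/2}}{1+x}-\frac{\alpha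 y^{2-\alpha/2}}{1+y}.$$ Assume $R_*\le r_k<r^*(\alpha)$ for $2\le k\le N+1$ and $$\tau_n\le\Big(\frac{4\epsilon^2}{\kappa}\,\frac{g(r_n,r_{n+1},\alpha)}{\Gamma(3-\alpha)}\Big)^{1/\alpha}\qquad\text{for }2\le n\le N .$$ **Conclusion.** 1. For $1\le n\le N$ the energies are well defined: $F(\phi^n)\in L^1(\Omega)$, and $\triangledown_\tau\phi^n$ has zero mean and belongs to the domain of $(-\Delta)^{-1}$. 2. The discrete energy dissipation law holds: $$\partial_\tau\mathcal E_\alpha[\phi^n]\le0\qquad\text{for }2\le n\le N .$$ 3. The modified energy is asymptotically compatible with that of the BDF2 scheme for the classical Cahn–Hilliard equation: on the given mesh, for $2\le n\le N$ and every fixed sequence of functions $\psi^0,\dots,\psi^n$ for which the energies are defined, $$\mathcal E_\beta[\psi^n]\longrightarrow E[\psi^n]+\frac{\sqrt{r_{n+1}}\,\tau_{n+1}}{2\kappa(1+r_{n+1})}\|\partial_\tau\psi^n\|_{-1}^2\qquad\text{as }\beta\to1^- .$$ -/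

import Mathlib

open MeasureTheory Filter Topology
open scoped ContDiff

noncomputable section

namespace TFCH

/-! ## Time mesh and the FBDF2 formula

A mesh is a sequence `t 0 < t 1 < ⋯` of nodes; only `t 0, …, t (N+1)` are ever used, and
`t (N+1)` enters only through the last step ratio `r (N+1)`.  A kernel written `x_{n-k}^{(n)}` in
the usual convolution notation is the value at `n k` of the corresponding Lean function. -/

/-- `ω_β(s) = s^(β-1) / Γ(β)`. -/
def omega (β s : ℝ) : ℝ := s ^ (β - 1) / Real.Gamma β

/-- Step size `τ_k = t_k - t_{k-1}` (for `k ≥ 1`). -/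
def step (t : ℕ → ℝ) (k : ℕ) : ℝ := t k - t (k - 1)

/-- Step ratio `r_1 = 0`, `r_k = τ_k / τ_{k-1}` for `k ≥ 2`. -/
def ratio (t : ℕ → ℝ) (k : ℕ) : ℝ := if k ≤ 1 then 0 else step t k / step t (k - 1)

/-- The quadratic polynomial `Π_{2,k} v` interpolating `v` at `t_{k-1}, t_k, t_{k+1}` (`k ≥ 1`). -/
def quadInterp (t : ℕ → ℝ) (v : ℕ → ℝ) (k : ℕ) : Polynomial ℝ :=
  Lagrange.interpolate (Finset.Icc (k - 1) (k + 1)) t v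

/-- `a_{n-k}^{(n)} = (1/τ_k) ∫_{t_{k-1}}^{t_k} ω_{1-α}(t_n - s) ds` for `1 ≤ k ≤ n`. -/
def kerA (α : ℝ) (t : ℕ → ℝ) (n k : ℕ) : ℝ :=
  1 / step t k * ∫ s in t (k - 1)..t k, omega (1 - α) (t n - s)

/-- `η_{n-k}^{(n)} = (2/τ_k) ∫_{t_{k-1}}^{t_k} ((s - t_{k-1/2})/τ_k) ω_{1-α}(t_n - s) ds`
for `1 ≤ k ≤ n`, where `t_{k-1/2} = (t_k + t_{k-1})/2`. -/
def kerEta (α : ℝ) (t : ℕ → ℝ) (n k : ℕ) : ℝ :=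
  2 / step t k *
    ∫ s in t (k - 1)..t k, (s - (t k + t (k - 1)) / 2) / step t k * omega (1 - α) (t n - s)

/-- The variable-step FBDF2 approximation `(∂_τ^α v)^n`, `n ≥ 1`, of the Caputo derivative of order
`α`: the L1 formula for `n = 1`, and piecewise quadratic interpolation for `n ≥ 2`. -/
def fbdf2 (α : ℝ) (t : ℕ → ℝ) (v : ℕ → ℝ) (n : ℕ) : ℝ :=
  if n ≤ 1 then kerA α t 1 1 * (v 1 - v 0)
  else
    (∫ s in t (n - 1)..t n,
        omega (1 - α) (t n - s) * (quadInterp t v (n - 1)).derivative.eval s)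
      + ∑ k ∈ Finset.Icc 1 (n - 1), ∫ s in t (k - 1)..t k,
          omega (1 - α) (t n - s) * (quadInterp t v k).derivative.eval s

/-- The kernels `â_{n-k}^{(n)}` of the nonlocal part of the FBDF2 formula, `1 ≤ k ≤ n`. -/
def kerHat (α : ℝ) (t : ℕ → ℝ) (n k : ℕ) : ℝ :=
  if n ≤ 1 then kerA α t 1 1
  else if k = n then
    (1 - α) / (2 - α) * kerA α t n n
      + kerEta α t n (n - 1) / (ratio t n * (1 + ratio t n))
  else if k = 1 then
    kerA α t n 1 - kerEta α t n 1 / (1 + ratio t 2)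
  else
    kerA α t n k - kerEta α t n k / (1 + ratio t (k + 1))
      + kerEta α t n (k - 1) / (ratio t k * (1 + ratio t k))

/-- `A_0^{(n)} = 2 â_0^{(n)}` and `A_{n-k}^{(n)} = â_{n-k}^{(n)}` for `1 ≤ k ≤ n-1`. -/
def kerMod (α : ℝ) (t : ℕ → ℝ) (n k : ℕ) : ℝ :=
  if k = n then 2 * kerHat α t n n else kerHat α t n k

/-! ## Step-ratio bounds -/

/-- `g₁(z, α) = 1/α + (1 + 1/α) z - z^(2 - α/2)`. -/
def gOne (z α : ℝ) : ℝ := 1 / α + (1 + 1 / α) * z - z ^ (2 - α / 2)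

/-- The function `g(x, y, α)`. -/
def gFun (x y α : ℝ) : ℝ :=
  (2 + 2 * (1 + α) * x - α * x ^ (2 - α / 2)) / (1 + x) - α * y ^ (2 - α / 2) / (1 + y)

/-- The lower bound `R_* ≈ 0.4753`. -/
def ratioLower : ℝ :=
  1 / 9 * (1 / 2 * (189 - 81 * √5)) ^ (1 / 3 : ℝ)
    + 1 / 3 * (1 / 2 * (7 + 3 * √5)) ^ (1 / 3 : ℝ) - 1 / 3

/-- The upper bound `r^*(α)`: the positive root of `g₁(·, α)` (see `ratioUpper_spec`). -/
def ratioUpper (α : ℝ) : ℝ := sInf {z : ℝ | 0 < z ∧ gOne z α = 0}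

theorem gOne_existsUnique {α : ℝ} (h0 : 0 < α) (h1 : α < 1) :
    ∃! z : ℝ, 0 < z ∧ gOne z α = 0 := by
  have ha : 0 < 1 / α := by positivity
  have hp : 0 < 1 - α / 2 := by linarith
  have key : ∀ z : ℝ, 0 < z →
      gOne z α = z * (1 / α / z + (1 + 1 / α) - z ^ (1 - α / 2)) := by
    intro z hz
    have : z ^ (2 - α / 2) = z * z ^ (1 - α / 2) := by
      rw [show (2 - α / 2 : ℝ) = 1 + (1 - α / 2) by ring, Real.rpow_add hz, Real.rpow_one]
    rw [gOne, this]
    field_simp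
  have anti : ∀ x y : ℝ, 0 < x → x < y →
      1 / α / y + (1 + 1 / α) - y ^ (1 - α / 2) < 1 / α / x + (1 + 1 / α) - x ^ (1 - α / 2) := by
    intro x y hx hxy
    have e1 : 1 / α / y < 1 / α / x := div_lt_div_of_pos_left ha hx hxy
    have e2 : x ^ (1 - α / 2) < y ^ (1 - α / 2) := Real.rpow_lt_rpow hx.le hxy hp
    linarith
  have uniq : ∀ x y : ℝ, 0 < x → gOne x α = 0 → 0 < y → gOne y α = 0 → ¬ x < y := by
    intro x y hx ex hy ey hxy
    rw [key x hx] at ex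
    rw [key y hy] at ey
    have ex' := (mul_eq_zero.mp ex).resolve_left hx.ne'
    have ey' := (mul_eq_zero.mp ey).resolve_left hy.ne'
    have := anti x y hx hxy
    linarith
  have hcont : Continuous fun z : ℝ => gOne z α := by
    unfold gOne
    have : Continuous fun z : ℝ => z ^ (2 - α / 2) :=
      Real.continuous_rpow_const (by linarith)
    fun_prop
  set M : ℝ := (2 + 2 / α) ^ (1 / (1 - α / 2)) with hM
  have hMpos : 0 < M := by positivity
  have hMge : 1 ≤ M := by
    apply Real.one_le_rpow
    · have : 0 < 2 / α := by positivity
      linarith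
    · positivity
  have hMp : M ^ (1 - α / 2) = 2 + 2 / α := by
    rw [hM, ← Real.rpow_mul (by positivity), one_div, inv_mul_cancel₀ hp.ne', Real.rpow_one]
  have hval : gOne M α ≤ 0 := by
    rw [key M hMpos, hMp]
    have e : 1 / α / M ≤ 1 / α := div_le_self ha.le hMge
    have e2 : 2 / α = 2 * (1 / α) := by ring
    exact mul_nonpos_of_nonneg_of_nonpos hMpos.le (by rw [e2]; linarith)
  have hzero : 0 < gOne 0 α := by
    rw [gOne, Real.zero_rpow (by linarith)]
    linarith
  obtain ⟨z, hz, ez⟩ := intermediate_value_Icc' hMpos.le hcont.continuousOn ⟨hval, hzero.le⟩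
  have hzpos : 0 < z := by
    rcases hz.1.lt_or_eq with h | h
    · exact h
    · rw [← h] at ez
      simp only at ez
      linarith
  refine ⟨z, ⟨hzpos, ez⟩, ?_⟩
  rintro y ⟨hy, ey⟩
  rcases lt_trichotomy y z with h | h | h
  · exact absurd h (uniq y z hy ey hzpos ez)
  · exact h
  · exact absurd h (uniq z y hzpos ez hy ey)

theorem ratioUpper_spec {α : ℝ} (h0 : 0 < α) (h1 : α < 1) :
    0 < ratioUpper α ∧ gOne (ratioUpper α) α = 0 := by
  obtain ⟨z, hz, hu⟩ := gOne_existsUnique h0 h1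
  have : {z : ℝ | 0 < z ∧ gOne z α = 0} = {z} := by
    ext y
    exact ⟨fun hy => hu y hy, fun hy => by rw [Set.mem_singleton_iff.mp hy]; exact hz⟩
  rw [ratioUpper, this, csInf_singleton]
  exact hz

/-! ## Spatial domain, Sobolev space, negative norm -/

/-- The plane with its Euclidean norm and Lebesgue measure. -/
abbrev Plane : Type := EuclideanSpace ℝ (Fin 2)

/-- The spatial domain together with its (mass-conserving) boundary condition: a domain `Ω` with
homogeneous Neumann conditions, or the rectangle `(0, L 0) × (0, L 1)` with periodic conditions. -/
inductive SpatialDomain : Type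
  | neumann (Ω : Set Plane) : SpatialDomain
  | periodic (L : Fin 2 → ℝ) : SpatialDomain

namespace SpatialDomain

/-- The set `Ω` over which all spatial integrals are taken. -/
def region : SpatialDomain → Set Plane
  | neumann Ω => Ω
  | periodic L => {x | ∀ i, 0 < x i ∧ x i < L i}

/-- Neumann: `Ω` is a bounded (open, connected, nonempty) domain; periodic: positive periods. -/
def Admissible : SpatialDomain → Prop
  | neumann Ω => IsOpen Ω ∧ IsConnected Ω ∧ Bornology.IsBounded Ω
  | periodic L => ∀ i, 0 < L i

/-- The open set on which functions live: `Ω` itself (Neumann), or the whole plane (periodic). -/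
def ambient : SpatialDomain → Set Plane
  | neumann Ω => Ω
  | periodic _ => Set.univ

/-- Periodicity of `u` in the periodic case; no condition in the Neumann case. -/
def Compatible : SpatialDomain → (Plane → ℝ) → Prop
  | neumann _, _ => True
  | periodic L, u => ∀ (x : Plane) (i : Fin 2), u (x + EuclideanSpace.single i (L i)) = u x

end SpatialDomain

/-- `g` is the weak (distributional) gradient of `u` on the open set `U`. -/
def HasWeakGrad (U : Set Plane) (u : Plane → ℝ) (g : Plane → Plane) : Prop :=
  LocallyIntegrableOn u U volume ∧ LocallyIntegrableOn g U volume ∧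
    ∀ ψ : Plane → ℝ, ContDiff ℝ ∞ ψ → HasCompactSupport ψ → tsupport ψ ⊆ U →
      ∫ x in U, u x • gradient ψ x = -∫ x in U, ψ x • g x

open Classical in
/-- The weak gradient `∇u` (unique up to null sets; `0` if there is none). -/
def weakGrad (U : Set Plane) (u : Plane → ℝ) : Plane → Plane :=
  if h : ∃ g, HasWeakGrad U u g then h.choose else 0

variable (D : SpatialDomain)

/-- Lebesgue measure on `Ω`. -/
def vol : Measure Plane := volume.restrict D.region

/-- The weak gradient of a function on the domain (or of a periodic function on the plane). -/
def grad (u : Plane → ℝ) : Plane → Plane := weakGrad D.ambient u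

/-- `u ∈ H¹(Ω)` (Neumann case), respectively `u ∈ H¹_per` (periodic case). -/
def InH1 (u : Plane → ℝ) : Prop :=
  D.Compatible u ∧ MemLp u 2 (vol D) ∧
    ∃ g, HasWeakGrad D.ambient u g ∧ MemLp g 2 (vol D)

/-- The Dirichlet form `⟨∇u, ∇v⟩`. -/
def dirichlet (u v : Plane → ℝ) : ℝ := ∫ x, inner ℝ (grad D u x) (grad D v x) ∂(vol D)

/-- `w = (-Δ)⁻¹ v`: `w` is the zero-mean weak solution of `-Δ w = v` under the given boundary
condition. -/
def IsInvNegLaplacian (v w : Plane → ℝ) : Prop :=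
  MemLp v 2 (vol D) ∧ InH1 D w ∧ ∫ x, w x ∂(vol D) = 0 ∧
    ∀ ψ, InH1 D ψ → dirichlet D w ψ = ∫ x, v x * ψ x ∂(vol D)

open Classical in
/-- The function `(-Δ)⁻¹ v` (`0` if there is no solution). -/
def invNegLaplacian (v : Plane → ℝ) : Plane → ℝ :=
  if h : ∃ w, IsInvNegLaplacian D v w then h.choose else 0

/-- `⟨v, w⟩_{-1} = ⟨(-Δ)⁻¹ v, w⟩`. -/
def negInner (v w : Plane → ℝ) : ℝ := ∫ x, invNegLaplacian D v x * w x ∂(vol D)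

/-- `‖v‖_{-1} = √⟨v, v⟩_{-1}`. -/
def negNorm (v : Plane → ℝ) : ℝ := √(negInner D v v)

/-! ## Scheme and energies -/

/-- The double-well potential `F(u) = (u² - 1)²/4`. -/
def potential (u : ℝ) : ℝ := 1 / 4 * (u ^ 2 - 1) ^ 2

/-- `f = F'`, that is `f(u) = u³ - u`. -/
def nonlin (u : ℝ) : ℝ := u ^ 3 - u

/-- `φ^0, …, φ^N` with chemical potentials `μ^1, …, μ^N` is a (weak) solution of the implicit
variable-step FBDF2 scheme `(∂_τ^α φ)^n = κ Δ μ^n`, `μ^n = f(φ^n) - ε² Δ φ^n`, `1 ≤ n ≤ N`. -/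
structure IsFBDF2Solution (α ε κ : ℝ) (t : ℕ → ℝ) (N : ℕ) (φ μ : ℕ → Plane → ℝ) : Prop where
  initial : MemLp (φ 0) 2 (vol D)
  phi_mem : ∀ n, 1 ≤ n → n ≤ N → InH1 D (φ n)
  nonlin_mem : ∀ n, 1 ≤ n → n ≤ N → MemLp (fun x => nonlin (φ n x)) 2 (vol D)
  mu_mem : ∀ n, 1 ≤ n → n ≤ N → InH1 D (μ n)
  evolution : ∀ n, 1 ≤ n → n ≤ N → ∀ ψ, InH1 D ψ →
    ∫ x, fbdf2 α t (fun k => φ k x) n * ψ x ∂(vol D) = -(κ * dirichlet D (μ n) ψ)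
  potential_eq : ∀ n, 1 ≤ n → n ≤ N → ∀ ψ, InH1 D ψ →
    ∫ x, μ n x * ψ x ∂(vol D)
      = ∫ x, nonlin (φ n x) * ψ x ∂(vol D) + ε ^ 2 * dirichlet D (φ n) ψ

/-- The Ginzburg–Landau energy `E[u] = (ε²/2) ‖∇u‖² + ⟨F(u), 1⟩`. -/
def freeEnergy (ε : ℝ) (u : Plane → ℝ) : ℝ :=
  ε ^ 2 / 2 * ∫ x, ‖grad D u x‖ ^ 2 ∂(vol D) + ∫ x, potential (u x) ∂(vol D)

/-- The increment `∇_τ φ^k = φ^k - φ^{k-1}`, `k ≥ 1`. -/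
def incr (φ : ℕ → Plane → ℝ) (k : ℕ) : Plane → ℝ := fun x => φ k x - φ (k - 1) x

/-- `⟨𝒢[w_n], 1⟩_{-1}`: the quadratic functional `𝒢[w_n]` in the sequence `w_1, …, w_n`, with each
square `(·)²` paired with `1` in `⟨·,·⟩_{-1}`, that is, replaced by `‖·‖_{-1}²`. -/
def gEnergy (α : ℝ) (t : ℕ → ℝ) (w : ℕ → Plane → ℝ) (n : ℕ) : ℝ :=
  α * ratio t (n + 1) ^ (2 - α / 2) / (2 * (1 + ratio t (n + 1)) * step t n ^ α)
      * (negNorm D (w n) ^ 2 / Real.Gamma (3 - α))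
    + 1 / 2 * ∑ j ∈ Finset.Icc 1 (n - 1), (kerMod α t n (j + 1) - kerMod α t n j)
        * negNorm D (fun x => ∑ l ∈ Finset.Icc (j + 1) n, w l x) ^ 2
    + 1 / 2 * kerMod α t n 1 * negNorm D (fun x => ∑ l ∈ Finset.Icc 1 n, w l x) ^ 2

/-- The modified energy `ℰ_α[φ^n] = E[φ^n] + (1/κ) ⟨𝒢[∇_τ φ^n], 1⟩_{-1}`, `n ≥ 1`. -/
def modEnergy (α ε κ : ℝ) (t : ℕ → ℝ) (φ : ℕ → Plane → ℝ) (n : ℕ) : ℝ :=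
  freeEnergy D ε (φ n) + 1 / κ * gEnergy D α t (incr φ) n

/-- The modified energy of the BDF2 scheme for the classical Cahn–Hilliard equation,
`E[φ^n] + √r_{n+1} τ_{n+1} / (2 κ (1 + r_{n+1})) ‖∂_τ φ^n‖_{-1}²`. -/
def bdf2Energy (ε κ : ℝ) (t : ℕ → ℝ) (φ : ℕ → Plane → ℝ) (n : ℕ) : ℝ :=
  freeEnergy D ε (φ n)
    + √(ratio t (n + 1)) * step t (n + 1) / (2 * κ * (1 + ratio t (n + 1)))
      * negNorm D (fun x => incr φ n x / step t n) ^ 2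

end TFCH

end

/-!
The dissipation law rests on a discrete gradient structure of the FBDF2 formula: tested with
`(-Δ)⁻¹` of the current increment, the fractional derivative does at least as much work as is
needed for the growth of the memory energy `𝒢`.

*Splitting.* Integrating the quadratic interpolants exactly, `fbdf2_succ` writes the formula as a
BDF2-like combination of the last two increments, with factor `1 / (Γ(3-α) τ_n^α)`, plus a
convolution of all increments with the kernels `â_{n-k}^{(n)}`. Young's inequality with weight
`r_n^(α/2)` handles the local part (`local_energy_le`); what is left over is exactly
`g(r_n, r_{n+1}, α) / (2 Γ(3-α) τ_n^α)` times the squared `-1`-norm of the increment.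

*Memory part.* Summation by parts (`convolution_energy_le`) shows that the convolution has a
gradient structure as soon as the oldest kernel and all differences of neighbouring kernels
`A_{n-j-1}^{(n)} - A_{n-j}^{(n)}` decrease in `n`. All kernels are combinations of two functionals
of the history kernel on single mesh intervals, its `mean` and its first moment `tilt`, so their
change in `n` is the same combination for `ψ(s) = ω_{1-α}(t_{n-1} - s) - ω_{1-α}(t_n - s)`
(`kerDrop`). This function is nonnegative, increasing and convex, and `ψ(t_j)` separates the two
neighbouring kernels: up to first moments over `[t_{j-1}, t_j]`, which have a favourable sign, the
kernel on the interval after `t_j` drops by at least `ψ(t_j)` and the one before `t_j` by at most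
`ψ(t_j)`. The second bound is where `R_*` enters: with `m = ψ'(t_{j-1})`, convexity gives `mean ψ
≤ ψ(t_j) - m τ_j / 2` on the `j`-th interval and `tilt ψ ≤ m τ_{j-1} / 6` on the one before it,
and these balance exactly when `3 r_j² (1 + r_j) ≥ 1`, that is `r_j ≥ R_*`
(`mean_add_tilt_kerDrop_le`, `ratioLower_spec`). On the interval that touches the singularity the
first bound follows from the primitive `x (x + d)^(1-α)` (`kerDrop_le_current`).

*Space.* Only the linearity and almost-everywhere uniqueness of the weak gradient are used. Since
`(-Δ)⁻¹` is symmetric, the `-1`-norm can be computed from any solution of the Poisson problem, so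
neither uniqueness nor solvability is needed: the scheme itself exhibits the inverse Laplacian of
each increment. The concave part of the potential costs half the squared `L²` norm of the
increment, which is interpolated between the Dirichlet norm and the `-1`-norm; the step-size
restriction absorbs the latter (`le_gFun_div_of_step_le`). This needs `g ≥ 0`, which holds below
`r^*(α)` (`gFun_nonneg`).

*Limit.* As `β → 1⁻` the factor `1 / Γ(1-β)` tends to zero, so all modified kernels vanish
(`tendsto_kerMod`) and the energy converges to its local part.
-/

namespace TFCH

/-! ### Mean and first moment over an interval -/

/-- The mean value of `f` over `[a, b]`. -/
noncomputable def mean (f : ℝ → ℝ) (a b : ℝ) : ℝ := 1 / (b - a) * ∫ s in a..b, f s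

/-- The scaled first moment of `f` over `[a, b]` about the midpoint. -/
noncomputable def tilt (f : ℝ → ℝ) (a b : ℝ) : ℝ :=
  2 / (b - a) * ∫ s in a..b, (s - (b + a) / 2) / (b - a) * f s

theorem kerA_eq_mean (α : ℝ) (t : ℕ → ℝ) (n k : ℕ) :
    kerA α t n k = mean (fun s => omega (1 - α) (t n - s)) (t (k - 1)) (t k) := rfl

theorem kerEta_eq_tilt (α : ℝ) (t : ℕ → ℝ) (n k : ℕ) :
    kerEta α t n k = tilt (fun s => omega (1 - α) (t n - s)) (t (k - 1)) (t k) := rfl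

section Functionals

variable {f g : ℝ → ℝ} {a b : ℝ}

theorem intervalIntegrable_tilt (hf : IntervalIntegrable f volume a b) :
    IntervalIntegrable (fun s => (s - (b + a) / 2) / (b - a) * f s) volume a b :=
  hf.continuousOn_mul (by fun_prop)

theorem mean_sub (hf : IntervalIntegrable f volume a b) (hg : IntervalIntegrable g volume a b) :
    mean (fun s => f s - g s) a b = mean f a b - mean g a b := by
  simp only [mean, intervalIntegral.integral_sub hf hg]
  ring

theorem tilt_sub (hf : IntervalIntegrable f volume a b) (hg : IntervalIntegrable g volume a b) :
    tilt (fun s => f s - g s) a b = tilt f a b - tilt g a b := by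
  simp only [tilt, mul_sub]
  rw [intervalIntegral.integral_sub (intervalIntegrable_tilt hf) (intervalIntegrable_tilt hg)]
  ring

theorem mean_affine (hab : a < b) (c m : ℝ) :
    mean (fun s => c + m * s) a b = c + m * ((a + b) / 2) := by
  have : b - a ≠ 0 := by linarith
  rw [mean, intervalIntegral.integral_add (by simp)
    (by apply Continuous.intervalIntegrable; fun_prop)]
  rw [intervalIntegral.integral_const, intervalIntegral.integral_const_mul, integral_id,
    smul_eq_mul]
  field_simp
  ring

theorem tilt_affine (hab : a < b) (c m : ℝ) :
    tilt (fun s => c + m * s) a b = m * (b - a) / 6 := by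
  have h : b - a ≠ 0 := by linarith
  have key : ∀ s : ℝ, (s - (b + a) / 2) / (b - a) * (c + m * s)
      = (-(b + a) / 2 * c / (b - a)) + ((c - m * (b + a) / 2) / (b - a)) * s
        + m / (b - a) * s ^ 2 := by
    intro s; field_simp; ring
  simp only [tilt, key]
  rw [intervalIntegral.integral_add (by apply Continuous.intervalIntegrable; fun_prop)
      (by apply Continuous.intervalIntegrable; fun_prop),
    intervalIntegral.integral_add (by simp) (by apply Continuous.intervalIntegrable; fun_prop)]
  rw [intervalIntegral.integral_const, intervalIntegral.integral_const_mul, integral_id,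
    intervalIntegral.integral_const_mul, integral_pow, smul_eq_mul]
  field_simp
  ring

theorem intervalIntegral_nonneg_of_Ioo (hab : a < b) (h : ∀ s ∈ Set.Ioo a b, 0 ≤ f s) :
    0 ≤ ∫ s in a..b, f s := by
  rw [intervalIntegral.integral_of_le hab.le, integral_Ioc_eq_integral_Ioo]
  exact setIntegral_nonneg measurableSet_Ioo h

/-- For `|θ| ≤ 1` the functional `mean - θ • tilt` integrates against a nonnegative weight. -/
theorem mean_sub_tilt_nonneg (hab : a < b) (hf : IntervalIntegrable f volume a b) {θ : ℝ}
    (h0 : 0 ≤ θ) (h1 : θ ≤ 1) (hpos : ∀ s ∈ Set.Ioo a b, 0 ≤ f s) :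
    0 ≤ mean f a b - θ * tilt f a b := by
  have hd : 0 < b - a := by linarith
  have e : mean f a b - θ * tilt f a b
      = 1 / (b - a) * ∫ s in a..b, (f s - 2 * θ * ((s - (b + a) / 2) / (b - a) * f s)) := by
    rw [intervalIntegral.integral_sub hf ((intervalIntegrable_tilt hf).const_mul _),
      intervalIntegral.integral_const_mul]
    simp only [mean, tilt]
    ring
  rw [e]
  refine mul_nonneg (by positivity) (intervalIntegral_nonneg_of_Ioo hab fun s hs => ?_)
  have hw : 0 ≤ 1 - 2 * θ * ((s - (b + a) / 2) / (b - a)) := by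
    have : (s - (b + a) / 2) / (b - a) ≤ 1 / 2 := by
      rw [div_le_iff₀ hd]
      linarith [hs.2]
    nlinarith
  have := mul_nonneg hw (hpos s hs)
  linarith

theorem mean_nonneg (hab : a < b) (hf : IntervalIntegrable f volume a b)
    (hpos : ∀ s ∈ Set.Ioo a b, 0 ≤ f s) : 0 ≤ mean f a b := by
  simpa using mean_sub_tilt_nonneg hab hf le_rfl zero_le_one hpos

theorem le_mean_sub_tilt (hab : a < b) (hf : IntervalIntegrable f volume a b) {θ c : ℝ}
    (h0 : 0 ≤ θ) (h1 : θ ≤ 1) (hc : ∀ s ∈ Set.Ioo a b, c ≤ f s) :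
    c ≤ mean f a b - θ * tilt f a b := by
  have hi : IntervalIntegrable (fun s : ℝ => c + 0 * s) volume a b := by
    apply Continuous.intervalIntegrable; fun_prop
  have := mean_sub_tilt_nonneg hab (hf.sub hi) h0 h1
    (fun s hs => by simpa using hc s hs)
  rw [mean_sub hf hi, tilt_sub hf hi, mean_affine hab, tilt_affine hab] at this
  linarith

theorem mean_le_affine (hab : a < b) (hf : IntervalIntegrable f volume a b) {m : ℝ}
    (h : ∀ s ∈ Set.Ioo a b, f s ≤ f b - m * (b - s)) :
    mean f a b ≤ f b - m * (b - a) / 2 := by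
  have hi : IntervalIntegrable (fun s : ℝ => (f b - m * b) + m * s) volume a b := by
    apply Continuous.intervalIntegrable; fun_prop
  have := mean_nonneg hab (hi.sub hf) (fun s hs => by have := h s hs; linarith)
  rw [mean_sub hi hf, mean_affine hab] at this
  linarith

theorem tilt_nonneg (hab : a < b) (hf : IntervalIntegrable f volume a b)
    (hm : MonotoneOn f (Set.Ioo a b)) : 0 ≤ tilt f a b := by
  have hd : 0 < b - a := by linarith
  set c := f ((b + a) / 2) with hc
  have hi : IntervalIntegrable (fun s : ℝ => c + 0 * s) volume a b := by
    apply Continuous.intervalIntegrable; fun_prop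
  have h0 : tilt f a b = tilt (fun s => f s - (c + 0 * s)) a b := by
    rw [tilt_sub hf hi, tilt_affine hab]; ring
  rw [h0, tilt]
  refine mul_nonneg (by positivity) (intervalIntegral_nonneg_of_Ioo hab fun s hs => ?_)
  have hmid : (b + a) / 2 ∈ Set.Ioo a b := ⟨by linarith, by linarith⟩
  rcases le_total s ((b + a) / 2) with h | h
  · have h2 := hm hs hmid h
    exact mul_nonneg_of_nonpos_of_nonpos (div_nonpos_of_nonpos_of_nonneg (by linarith) hd.le)
      (by linarith)
  · have h2 := hm hmid hs h
    exact mul_nonneg (div_nonneg (by linarith) hd.le) (by linarith)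

theorem tilt_le_of_antitoneOn (hab : a < b) (hf : IntervalIntegrable f volume a b) {m : ℝ}
    (hm : AntitoneOn (fun s => f s - m * s) (Set.Ioo a b)) : tilt f a b ≤ m * (b - a) / 6 := by
  have hi : IntervalIntegrable (fun s : ℝ => 0 + m * s) volume a b := by
    apply Continuous.intervalIntegrable; fun_prop
  have := tilt_nonneg hab (hi.sub hf) fun x hx y hy hxy => by
    have := hm hx hy hxy
    simp only at this ⊢
    linarith
  rw [tilt_sub hi hf, tilt_affine hab] at this
  linarith

end Functionals

theorem intervalIntegrable_omega {α : ℝ} (h1 : α < 1) (T a b : ℝ) :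
    IntervalIntegrable (fun s => omega (1 - α) (T - s)) volume a b := by
  have h := (intervalIntegral.intervalIntegrable_rpow' (a := T - a) (b := T - b)
    (show -1 < 1 - α - 1 by linarith)).comp_sub_left T
  rw [sub_sub_cancel, sub_sub_cancel] at h
  exact h.div_const _

/-! ### The difference of two history kernels -/

/-- The decrease of the history kernel at time `s` when the observation time moves from `T` to
`T'`. -/
noncomputable def kerDrop (α T T' s : ℝ) : ℝ := omega (1 - α) (T - s) - omega (1 - α) (T' - s)

theorem intervalIntegrable_kerDrop {α : ℝ} (h1 : α < 1) (T T' a b : ℝ) :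
    IntervalIntegrable (kerDrop α T T') volume a b :=
  (intervalIntegrable_omega h1 T a b).sub (intervalIntegrable_omega h1 T' a b)

theorem hasDerivAt_rpow_drop (p : ℝ) {T T' s : ℝ} (hT : T ≤ T') (hs : s < T) :
    HasDerivAt (fun s : ℝ => (T - s) ^ (-p) - (T' - s) ^ (-p))
      (p * ((T - s) ^ (-(p + 1)) - (T' - s) ^ (-(p + 1)))) s := by
  have h1 := ((hasDerivAt_id s).const_sub T).rpow_const (p := -p) (Or.inl (by simp; linarith))
  have h2 := ((hasDerivAt_id s).const_sub T').rpow_const (p := -p) (Or.inl (by simp; linarith))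
  refine (h1.sub h2).congr_deriv ?_
  simp only [id, show -p - 1 = -(p + 1) by ring]
  ring

theorem rpow_drop_nonneg {p : ℝ} (hp : 0 ≤ p) {T T' s : ℝ} (hT : T ≤ T') (hs : s < T) :
    0 ≤ (T - s) ^ (-p) - (T' - s) ^ (-p) :=
  sub_nonneg.mpr (Real.rpow_le_rpow_of_nonpos (by linarith) (by linarith) (by linarith))

/-- The derivative of a difference of powers is again one, with the exponent raised by one, so this
lemma yields both the monotonicity and the convexity of the history kernel's drop. -/
theorem monotoneOn_rpow_drop {p : ℝ} (hp : 0 ≤ p) {T T' : ℝ} (hT : T ≤ T') :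
    MonotoneOn (fun s : ℝ => (T - s) ^ (-p) - (T' - s) ^ (-p)) (Set.Iio T) := by
  refine monotoneOn_of_hasDerivWithinAt_nonneg (convex_Iio T)
    (fun s hs => (hasDerivAt_rpow_drop p hT hs).continuousAt.continuousWithinAt)
    (fun s hs => (hasDerivAt_rpow_drop p hT (by simpa using hs)).hasDerivWithinAt) fun s hs => ?_
  exact mul_nonneg hp (rpow_drop_nonneg (by linarith) hT (by simpa using hs))

theorem kerDrop_eq (α T T' : ℝ) : kerDrop α T T'
    = fun s => ((T - s) ^ (-α) - (T' - s) ^ (-α)) / Real.Gamma (1 - α) := by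
  funext s
  simp only [kerDrop, omega, show 1 - α - 1 = -α by ring]
  ring

section

variable {α T T' : ℝ}

theorem kerDrop_nonneg (h0 : 0 < α) (h1 : α < 1) (hT : T ≤ T') {s : ℝ} (hs : s < T) :
    0 ≤ kerDrop α T T' s := by
  rw [kerDrop_eq]
  exact div_nonneg (rpow_drop_nonneg h0.le hT hs) (Real.Gamma_pos_of_pos (by linarith)).le

theorem monotoneOn_kerDrop (h0 : 0 < α) (h1 : α < 1) (hT : T ≤ T') :
    MonotoneOn (kerDrop α T T') (Set.Iio T) := by
  rw [kerDrop_eq]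
  exact fun x hx y hy hxy => div_le_div_of_nonneg_right (monotoneOn_rpow_drop h0.le hT hx hy hxy)
    (Real.Gamma_pos_of_pos (by linarith)).le

/-- The derivative of `kerDrop α T T'`. -/
noncomputable def kerDropDeriv (α T T' s : ℝ) : ℝ :=
  α * ((T - s) ^ (-(α + 1)) - (T' - s) ^ (-(α + 1))) / Real.Gamma (1 - α)

theorem hasDerivAt_kerDrop (hT : T ≤ T') {s : ℝ} (hs : s < T) :
    HasDerivAt (kerDrop α T T') (kerDropDeriv α T T' s) s := by
  rw [kerDrop_eq]
  exact (hasDerivAt_rpow_drop α hT hs).div_const _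

theorem monotoneOn_kerDropDeriv (h0 : 0 < α) (h1 : α < 1) (hT : T ≤ T') :
    MonotoneOn (kerDropDeriv α T T') (Set.Iio T) := fun x hx y hy hxy =>
  div_le_div_of_nonneg_right (mul_le_mul_of_nonneg_left
    (monotoneOn_rpow_drop (by linarith) hT hx hy hxy) h0.le)
    (Real.Gamma_pos_of_pos (by linarith)).le

theorem kerDropDeriv_nonneg (h0 : 0 < α) (h1 : α < 1) (hT : T ≤ T') {s : ℝ} (hs : s < T) :
    0 ≤ kerDropDeriv α T T' s :=
  div_nonneg (mul_nonneg h0.le (rpow_drop_nonneg (by linarith) hT hs))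
    (Real.Gamma_pos_of_pos (by linarith)).le

theorem hasDerivAt_kerDrop_sub (hT : T ≤ T') (m : ℝ) {s : ℝ} (hs : s < T) :
    HasDerivAt (fun s => kerDrop α T T' s - m * s) (kerDropDeriv α T T' s - m) s := by
  simpa using! (hasDerivAt_kerDrop hT hs).sub ((hasDerivAt_id s).const_mul m)

/-- By convexity of `kerDrop`, the slope `m` at `x₁` bounds it from above on `[x₁, x₂]` and bounds
its moment on `[x₀, x₁]`; the two bounds balance when `ρ (x₁ - x₀) ≤ 3 (x₂ - x₁)`. -/
theorem mean_add_tilt_kerDrop_le (h0 : 0 < α) (h1 : α < 1) (hT : T ≤ T') {x₀ x₁ x₂ ρ : ℝ}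
    (h01 : x₀ < x₁) (h12 : x₁ < x₂) (h2T : x₂ < T) (hρ : 0 ≤ ρ)
    (hbal : ρ * (x₁ - x₀) ≤ 3 * (x₂ - x₁)) :
    mean (kerDrop α T T') x₁ x₂ + ρ * tilt (kerDrop α T T') x₀ x₁ ≤ kerDrop α T T' x₂ := by
  set m := kerDropDeriv α T T' x₁ with hm
  have hm0 : 0 ≤ m := kerDropDeriv_nonneg h0 h1 hT (by linarith)
  have hanti : AntitoneOn (fun s => kerDrop α T T' s - m * s) (Set.Ioo x₀ x₁) := by
    refine antitoneOn_of_hasDerivWithinAt_nonpos (convex_Ioo _ _)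
      (fun s hs => (hasDerivAt_kerDrop_sub hT m
        (by linarith [hs.2])).continuousAt.continuousWithinAt)
      (fun s hs => (hasDerivAt_kerDrop_sub hT m ?_).hasDerivWithinAt) fun s hs => ?_
    · rw [interior_Ioo] at hs; linarith [hs.2]
    · rw [interior_Ioo] at hs
      exact sub_nonpos.mpr (monotoneOn_kerDropDeriv h0 h1 hT
        (show s < T by linarith [hs.2]) (show x₁ < T by linarith) hs.2.le)
  have hmono : MonotoneOn (fun s => kerDrop α T T' s - m * s) (Set.Icc x₁ x₂) := by
    refine monotoneOn_of_hasDerivWithinAt_nonneg (convex_Icc _ _)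
      (fun s hs => (hasDerivAt_kerDrop_sub hT m
        (by linarith [hs.2])).continuousAt.continuousWithinAt)
      (fun s hs => (hasDerivAt_kerDrop_sub hT m ?_).hasDerivWithinAt) fun s hs => ?_
    · rw [interior_Icc] at hs; linarith [hs.2]
    · rw [interior_Icc] at hs
      exact sub_nonneg.mpr (monotoneOn_kerDropDeriv h0 h1 hT
        (show x₁ < T by linarith) (show s < T by linarith [hs.2]) hs.1.le)
  have hA := mean_le_affine h12 (intervalIntegrable_kerDrop h1 T T' x₁ x₂) (m := m) fun s hs => by
    have := hmono ⟨hs.1.le, hs.2.le⟩ (Set.right_mem_Icc.mpr h12.le) hs.2.le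
    simp only at this
    linarith
  have hE := tilt_le_of_antitoneOn h01 (intervalIntegrable_kerDrop h1 T T' x₀ x₁) hanti
  have h3 := mul_le_mul_of_nonneg_left hE hρ
  have h4 := mul_le_mul_of_nonneg_left hbal hm0
  nlinarith

theorem mean_kerDrop_le (h0 : 0 < α) (h1 : α < 1) (hT : T ≤ T') {x₁ x₂ : ℝ}
    (h12 : x₁ < x₂) (h2T : x₂ < T) : mean (kerDrop α T T') x₁ x₂ ≤ kerDrop α T T' x₂ := by
  have := mean_add_tilt_kerDrop_le h0 h1 hT (x₀ := x₁ - 1) (by linarith) h12 h2T le_rfl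
    (by linarith)
  simpa using this

end

/-! ### The two kernels on the current interval -/

theorem integral_omega {α : ℝ} (h1 : α < 1) (h : ℝ) :
    ∫ x in (0 : ℝ)..h, omega (1 - α) x = h ^ (1 - α) / ((1 - α) * Real.Gamma (1 - α)) := by
  simp only [omega, intervalIntegral.integral_div]
  rw [integral_rpow (Or.inl (by linarith)), Real.zero_rpow (by linarith),
    show 1 - α - 1 + 1 = 1 - α by ring]
  simp [div_div]

theorem integral_id_mul_omega {α : ℝ} (h1 : α < 1) {h : ℝ} (hh : 0 ≤ h) :
    ∫ x in (0 : ℝ)..h, x * omega (1 - α) x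
      = h ^ (2 - α) / ((2 - α) * Real.Gamma (1 - α)) := by
  have : ∀ x ∈ Set.uIcc 0 h, x * omega (1 - α) x = x ^ (1 - α) / Real.Gamma (1 - α) := by
    intro x hx
    rw [Set.uIcc_of_le hh] at hx
    rcases hx.1.eq_or_lt with h | h
    · rw [← h, Real.zero_rpow (by linarith)]; simp
    · rw [omega, show 1 - α = 1 + (1 - α - 1) by ring, Real.rpow_add h, Real.rpow_one]
      ring_nf
  rw [intervalIntegral.integral_congr this, intervalIntegral.integral_div,
    integral_rpow (Or.inl (by linarith)), Real.zero_rpow (by linarith),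
    show 1 - α + 1 = 2 - α by ring]
  simp [div_div]

theorem mean_omega_current {α : ℝ} (h1 : α < 1) {a T : ℝ} (haT : a < T) :
    mean (fun s => omega (1 - α) (T - s)) a T
      = (T - a) ^ (-α) / ((1 - α) * Real.Gamma (1 - α)) := by
  have hd : 0 < T - a := by linarith
  have h := intervalIntegral.integral_comp_sub_left (a := a) (b := T)
    (fun x => omega (1 - α) x) T
  rw [sub_self] at h
  rw [mean, h, integral_omega h1, show 1 - α = 1 + -α by ring, Real.rpow_add hd, Real.rpow_one]
  field_simp

/-- `η₀ = α / (2 - α) a₀`. -/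
theorem tilt_omega_current {α : ℝ} (h1 : α < 1) {a T : ℝ} (haT : a < T) :
    tilt (fun s => omega (1 - α) (T - s)) a T
      = α / (2 - α) * mean (fun s => omega (1 - α) (T - s)) a T := by
  have hd : 0 < T - a := by linarith
  have hG : 0 < Real.Gamma (1 - α) := Real.Gamma_pos_of_pos (by linarith)
  have hα : 0 < 1 - α := by linarith
  have hα2 : 0 < 2 - α := by linarith
  rw [mean_omega_current h1 haT]
  set h := T - a with hh
  have e1 : ∫ s in a..T, (s - (T + a) / 2) / (T - a) * omega (1 - α) (T - s)
      = ∫ x in (0 : ℝ)..h, (1 / 2 - x / h) * omega (1 - α) x := by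
    have := intervalIntegral.integral_comp_sub_left (a := a) (b := T)
      (fun x => (1 / 2 - x / h) * omega (1 - α) x) T
    rw [sub_self, ← hh] at this
    rw [← this]
    refine intervalIntegral.integral_congr fun s _ => ?_
    congr 1
    have hTa : T - a ≠ 0 := hd.ne'
    rw [hh]
    field_simp
    ring
  have i0 : IntervalIntegrable (fun x => omega (1 - α) x) volume 0 h :=
    (intervalIntegral.intervalIntegrable_rpow' (by linarith)).div_const _
  have i1 : IntervalIntegrable (fun x => x * omega (1 - α) x) volume 0 h :=
    i0.continuousOn_mul (by fun_prop)
  have e2 : ∫ x in (0 : ℝ)..h, (1 / 2 - x / h) * omega (1 - α) x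
      = 1 / 2 * (∫ x in (0 : ℝ)..h, omega (1 - α) x)
        - 1 / h * ∫ x in (0 : ℝ)..h, x * omega (1 - α) x := by
    rw [← intervalIntegral.integral_const_mul, ← intervalIntegral.integral_const_mul,
      ← intervalIntegral.integral_sub (i0.const_mul _) (i1.const_mul _)]
    exact intervalIntegral.integral_congr fun x _ => by ring
  rw [tilt, e1, e2, integral_omega h1, integral_id_mul_omega h1 hd.le,
    show 1 - α = 1 + -α by ring, show 2 - α = 1 + 1 + -α by ring, Real.rpow_add hd,
    Real.rpow_add hd, Real.rpow_add hd, Real.rpow_one]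
  rw [← hh]
  rw [show 1 + -α = 1 - α by ring, show 1 + 1 + -α = 2 - α by ring]
  field_simp
  ring

/-- On the interval `[a, T]` adjacent to the singularity, the weight of `a₀ - η₀` at the earlier
time `T` still dominates the one at the later time `T'` by the value of `kerDrop` at `a`. -/
theorem kerDrop_le_current {α : ℝ} (h0 : 0 < α) (h1 : α < 1) {a T T' : ℝ} (haT : a < T)
    (hT : T < T') :
    kerDrop α T T' a ≤ 2 * ((1 - α) / (2 - α) * mean (fun s => omega (1 - α) (T - s)) a T)
      - (mean (fun s => omega (1 - α) (T' - s)) a T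
        - tilt (fun s => omega (1 - α) (T' - s)) a T / (1 + (T' - T) / (T - a))) := by
  have hG : 0 < Real.Gamma (1 - α) := Real.Gamma_pos_of_pos (by linarith)
  have hα : 0 < 1 - α := by linarith
  have hα2 : 0 < 2 - α := by linarith
  set h := T - a with hh
  set d := T' - T with hd
  have hpos : 0 < h := by linarith
  have dpos : 0 < d := by linarith
  have hTa : T' - a = h + d := by rw [hh, hd]; ring
  -- the primitive `x (x + d)^(1-α)` evaluates the weighted mean up to a term in `x (x + d)^(-α)`
  have hF : ∀ x ∈ Set.uIcc 0 h, HasDerivAt (fun x : ℝ => x * (x + d) ^ (1 - α))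
      ((d + (2 - α) * x) * (x + d) ^ (-α)) x := by
    intro x hx
    rw [Set.uIcc_of_le hpos.le] at hx
    have hxd : 0 < x + d := by linarith [hx.1]
    have h2 := ((hasDerivAt_id x).add_const d).rpow_const (p := 1 - α) (Or.inl hxd.ne')
    refine ((hasDerivAt_id x).mul h2).congr_deriv ?_
    simp only [id]
    rw [show 1 - α - 1 = -α by ring, show 1 - α = 1 + -α by ring, Real.rpow_add hxd, Real.rpow_one]
    ring
  have hcont : ContinuousOn (fun x : ℝ => (x + d) ^ (-α)) (Set.uIcc 0 h) := by
    refine ContinuousOn.rpow_const (by fun_prop) fun x hx => Or.inl ?_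
    rw [Set.uIcc_of_le hpos.le] at hx
    linarith [hx.1]
  have hint := intervalIntegral.integral_eq_sub_of_hasDerivAt hF
    (ContinuousOn.intervalIntegrable (by fun_prop))
  have hle : ∫ x in (0 : ℝ)..h, (d + 2 * x) * (x + d) ^ (-α)
      ≤ ∫ x in (0 : ℝ)..h, ((d + (2 - α) * x) * (x + d) ^ (-α) + α * x ^ (1 - α)) := by
    have ic : IntervalIntegrable (fun x : ℝ => α * x ^ (1 - α)) volume 0 h :=
      (intervalIntegral.intervalIntegrable_rpow' (by linarith)).const_mul _
    refine intervalIntegral.integral_mono_on hpos.le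
      (ContinuousOn.intervalIntegrable (by fun_prop))
      ((ContinuousOn.intervalIntegrable (by fun_prop)).add ic) fun x hx => ?_
    have : x * (x + d) ^ (-α) ≤ x ^ (1 - α) := by
      rcases hx.1.eq_or_lt with h | h
      · rw [← h, Real.zero_rpow (by linarith)]; simp
      · rw [show 1 - α = 1 + -α by ring, Real.rpow_add h, Real.rpow_one]
        exact mul_le_mul_of_nonneg_left
          (Real.rpow_le_rpow_of_nonpos h (by linarith) (by linarith)) h.le
    nlinarith
  rw [intervalIntegral.integral_add (ContinuousOn.intervalIntegrable (by fun_prop))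
    ((intervalIntegral.intervalIntegrable_rpow' (by linarith)).const_mul _), hint,
    intervalIntegral.integral_const_mul, integral_rpow (Or.inl (by linarith)),
    Real.zero_rpow (by linarith)] at hle
  have e0 : mean (fun s => omega (1 - α) (T' - s)) a T
        - tilt (fun s => omega (1 - α) (T' - s)) a T / (1 + d / h)
      = 1 / (h * (h + d) * Real.Gamma (1 - α)) *
        ∫ x in (0 : ℝ)..h, (d + 2 * x) * (x + d) ^ (-α) := by
    have := intervalIntegral.integral_comp_sub_left (a := a) (b := T)
      (fun x => (d + 2 * x) * (x + d) ^ (-α)) T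
    rw [sub_self, ← hh] at this
    rw [← this]
    have io := intervalIntegrable_omega h1 T' a T
    have e2 : ∀ s, (d + 2 * (T - s)) * (T - s + d) ^ (-α)
        = Real.Gamma (1 - α) * ((h + d) * omega (1 - α) (T' - s)
          - 2 * h * ((s - (T + a) / 2) / (T - a) * omega (1 - α) (T' - s))) := by
      intro s
      rw [omega, show 1 - α - 1 = -α by ring, show T - s + d = T' - s by rw [hd]; ring, ← hh]
      field_simp
      rw [hh]
      ring
    simp only [e2]
    rw [intervalIntegral.integral_const_mul, intervalIntegral.integral_sub (io.const_mul _)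
      ((intervalIntegrable_tilt io).const_mul _), intervalIntegral.integral_const_mul,
      intervalIntegral.integral_const_mul, mean, tilt, ← hh]
    field_simp
  rw [e0, mean_omega_current h1 haT, kerDrop_eq]
  simp only
  rw [hTa, ← hh]
  have hhd : 0 < h + d := by linarith
  have r1 : (h + d) ^ (1 - α) = (h + d) * (h + d) ^ (-α) := by
    rw [show 1 - α = 1 + -α by ring, Real.rpow_add hhd, Real.rpow_one]
  have r2 : h ^ (1 - α + 1) = h * (h * h ^ (-α)) := by
    rw [show 1 - α + 1 = 1 + (1 + -α) by ring, Real.rpow_add hpos, Real.rpow_add hpos,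
      Real.rpow_one]
  rw [r1, r2] at hle
  set P := (h + d) ^ (-α)
  set Q := h ^ (-α) with hQ
  have hQ0 : 0 < Q := Real.rpow_pos_of_pos hpos _
  have b1 : 1 / (h * (h + d) * Real.Gamma (1 - α)) *
        (∫ x in (0 : ℝ)..h, (d + 2 * x) * (x + d) ^ (-α))
      ≤ (P + α * Q / (2 - α)) / Real.Gamma (1 - α) := by
    have b2 : (∫ x in (0 : ℝ)..h, (d + 2 * x) * (x + d) ^ (-α))
        ≤ h * (h + d) * (P + α * Q / (2 - α)) := by
      refine hle.trans ?_
      have : 0 ≤ h * d * (α * Q / (2 - α)) := by positivity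
      have e : α * ((h * (h * Q) - 0) / (1 - α + 1)) = h * h * (α * Q / (2 - α)) := by
        rw [show 1 - α + 1 = 2 - α by ring]; ring
      rw [e]
      linarith
    calc _ ≤ 1 / (h * (h + d) * Real.Gamma (1 - α)) * (h * (h + d) * (P + α * Q / (2 - α))) :=
          mul_le_mul_of_nonneg_left b2 (by positivity)
      _ = _ := by field_simp
  have b3 : 2 * ((1 - α) / (2 - α) * (Q / ((1 - α) * Real.Gamma (1 - α))))
      = (Q + α * Q / (2 - α)) / Real.Gamma (1 - α) := by
    field_simp
    ring
  rw [b3]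
  have : (Q - P) / Real.Gamma (1 - α) = (Q + α * Q / (2 - α)) / Real.Gamma (1 - α)
      - (P + α * Q / (2 - α)) / Real.Gamma (1 - α) := by ring
  linarith

/-! ### The history kernel as a function of the past -/

theorem omega_nonneg {α : ℝ} (h1 : α < 1) {x : ℝ} (hx : 0 ≤ x) : 0 ≤ omega (1 - α) x :=
  div_nonneg (Real.rpow_nonneg hx _) (Real.Gamma_pos_of_pos (by linarith)).le

theorem omega_le_omega {α : ℝ} (h0 : 0 < α) (h1 : α < 1) {x y : ℝ} (hx : 0 < x) (hxy : x ≤ y) :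
    omega (1 - α) y ≤ omega (1 - α) x :=
  div_le_div_of_nonneg_right (Real.rpow_le_rpow_of_nonpos hx hxy (by linarith))
    (Real.Gamma_pos_of_pos (by linarith)).le

theorem tilt_omega_nonneg {α : ℝ} (h0 : 0 < α) (h1 : α < 1) {a b T : ℝ} (hab : a < b)
    (hb : b ≤ T) : 0 ≤ tilt (fun s => omega (1 - α) (T - s)) a b :=
  tilt_nonneg hab (intervalIntegrable_omega h1 T a b) fun x _ y hy hxy =>
    omega_le_omega h0 h1 (by linarith [hy.2]) (by linarith)

theorem tilt_omega_le_mean {α : ℝ} (h1 : α < 1) {a b T : ℝ} (hab : a < b)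
    (hb : b ≤ T) : tilt (fun s => omega (1 - α) (T - s)) a b
      ≤ mean (fun s => omega (1 - α) (T - s)) a b := by
  have := mean_sub_tilt_nonneg hab (intervalIntegrable_omega h1 T a b) zero_le_one le_rfl
    fun s hs => omega_nonneg h1 (by linarith [hs.2])
  linarith

theorem mean_omega_nonneg {α : ℝ} (h1 : α < 1) {a b T : ℝ} (hab : a < b)
    (hb : b ≤ T) : 0 ≤ mean (fun s => omega (1 - α) (T - s)) a b :=
  mean_nonneg hab (intervalIntegrable_omega h1 T a b)
    fun s hs => omega_nonneg h1 (by linarith [hs.2])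

theorem mean_omega_le {α : ℝ} (h0 : 0 < α) (h1 : α < 1) {a b T : ℝ} (hab : a < b)
    (hb : b < T) : mean (fun s => omega (1 - α) (T - s)) a b ≤ omega (1 - α) (T - b) := by
  have := mean_le_affine hab (intervalIntegrable_omega h1 T a b) (m := 0)
    fun s hs => by
      have := omega_le_omega h0 h1 (show 0 < T - b by linarith)
        (show T - b ≤ T - s by linarith [hs.2])
      linarith
  simpa using this

/-! ### The mesh -/

section Mesh

variable {N : ℕ} {t : ℕ → ℝ}

theorem mesh_lt (ht : ∀ k, k ≤ N → t k < t (k + 1)) {i j : ℕ} (hij : i < j) (hj : j ≤ N + 1) :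
    t i < t j := by
  induction j, hij using Nat.le_induction with
  | base => exact ht i (by omega)
  | succ j hij ih => exact (ih (by omega)).trans (ht j (by omega))

theorem mesh_le (ht : ∀ k, k ≤ N → t k < t (k + 1)) {i j : ℕ} (hij : i ≤ j) (hj : j ≤ N + 1) :
    t i ≤ t j := by
  rcases hij.eq_or_lt with rfl | h
  · exact le_rfl
  · exact (mesh_lt ht h hj).le

theorem step_pos (ht : ∀ k, k ≤ N → t k < t (k + 1)) {k : ℕ} (hk : 1 ≤ k) (hk' : k ≤ N + 1) :
    0 < step t k :=
  sub_pos.mpr (mesh_lt ht (by omega) hk')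

theorem ratio_succ {k : ℕ} (hk : 1 ≤ k) : ratio t (k + 1) = step t (k + 1) / step t k := by
  rw [ratio, if_neg (by omega), Nat.add_sub_cancel]

theorem ratio_succ_pos (ht : ∀ k, k ≤ N → t k < t (k + 1)) {k : ℕ} (hk : 1 ≤ k) (hk' : k ≤ N) :
    0 < ratio t (k + 1) := by
  rw [ratio_succ hk]
  exact div_pos (step_pos ht (by omega) (by omega)) (step_pos ht hk (by omega))

theorem ratio_pos (ht : ∀ k, k ≤ N → t k < t (k + 1)) {k : ℕ} (hk : 2 ≤ k) (hk' : k ≤ N + 1) :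
    0 < ratio t k := by
  obtain ⟨k, rfl⟩ := Nat.exists_eq_add_of_le' (show 1 ≤ k by omega)
  exact ratio_succ_pos ht (by omega) (by omega)

end Mesh

/-! ### Step-ratio bounds -/

/-- `R_*` is the positive root of `3 z² (1 + z) = 1`. -/
theorem ratioLower_spec : 0 < ratioLower ∧ 3 * ratioLower ^ 2 * (1 + ratioLower) = 1 := by
  have h5 : (√5 : ℝ) ^ 2 = 5 := Real.sq_sqrt (by norm_num)
  have h5p : 0 < (√5 : ℝ) := by positivity
  have h5l : (√5 : ℝ) < 7 / 3 := by nlinarith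
  set X : ℝ := 1 / 2 * (189 - 81 * √5) with hX
  set Y : ℝ := 1 / 2 * (7 + 3 * √5) with hY
  have hX0 : 0 < X := by rw [hX]; linarith
  have hY1 : 1 < Y := by rw [hY]; linarith
  have hXY : X * Y = 27 := by rw [hX, hY]; nlinarith
  set A : ℝ := X ^ (1 / 3 : ℝ) with hA
  set B : ℝ := Y ^ (1 / 3 : ℝ) with hB
  have cube : ∀ z : ℝ, 0 ≤ z → (z ^ (1 / 3 : ℝ)) ^ 3 = z := by
    intro z hz
    rw [← Real.rpow_natCast, ← Real.rpow_mul hz]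
    norm_num
  have hA3 : A ^ 3 = X := cube X hX0.le
  have hB3 : B ^ 3 = Y := cube Y (by linarith)
  have hA0 : 0 < A := Real.rpow_pos_of_pos hX0 _
  have hB1 : 1 < B := Real.one_lt_rpow hY1 (by norm_num)
  have hAB : A * B = 3 := by
    rw [hA, hB, ← Real.mul_rpow hX0.le (by linarith), hXY, show (27 : ℝ) = 3 ^ (3 : ℝ) by norm_num,
      ← Real.rpow_mul (by norm_num)]
    norm_num
  have hR : ratioLower = A / 9 + B / 3 - 1 / 3 := by
    rw [ratioLower]; ring
  refine ⟨by rw [hR]; linarith, ?_⟩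
  -- Cardano: `y = A / 9 + B / 3` solves `y³ = y / 3 + 7 / 27`
  have hy : (A / 9 + B / 3) ^ 3 = 7 / 27 + (A / 9 + B / 3) / 3 := by
    have : (A / 9 + B / 3) ^ 3
        = A ^ 3 / 729 + B ^ 3 / 27 + (A * B) / 9 * (A / 9 + B / 3) := by ring
    rw [this, hA3, hB3, hAB, hX, hY]
    ring
  rw [hR]
  linear_combination 3 * hy

theorem one_le_of_ratioLower_le {z : ℝ} (hz : ratioLower ≤ z) : 1 ≤ 3 * z ^ 2 * (1 + z) := by
  obtain ⟨h0, h⟩ := ratioLower_spec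
  calc 1 = 3 * ratioLower ^ 2 * (1 + ratioLower) := h.symm
    _ ≤ 3 * z ^ 2 * (1 + z) := by gcongr

/-- Nonnegativity of `g` matters because a negative base would make the real power in the
step-size restriction meaningless. -/
theorem gFun_nonneg {α x y : ℝ} (h0 : 0 < α) (h1 : α < 1) (hx : 0 < x) (hxR : x < ratioUpper α)
    (hy : 0 < y) (hyR : y < ratioUpper α) : 0 ≤ gFun x y α := by
  obtain ⟨hR, hRz⟩ := ratioUpper_spec h0 h1
  set R := ratioUpper α
  set Q := R ^ (1 - α / 2) with hQ
  have split : ∀ z : ℝ, 0 < z → z ^ (2 - α / 2) = z * z ^ (1 - α / 2) := fun z hz => by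
    rw [show (2 - α / 2 : ℝ) = 1 + (1 - α / 2) by ring, Real.rpow_add hz, Real.rpow_one]
  have le : ∀ z : ℝ, 0 < z → z < R → z ^ (2 - α / 2) ≤ z * Q := fun z hz hzR => by
    rw [split z hz]
    exact mul_le_mul_of_nonneg_left (Real.rpow_le_rpow hz.le hzR.le (by linarith)) hz.le
  have hQR : α * R * Q = 1 + (1 + α) * R := by
    rw [gOne, split R hR, ← hQ] at hRz
    field_simp at hRz
    linarith
  -- both power terms are linearised at `R`
  have ey : α * y ^ (2 - α / 2) / (1 + y) ≤ (1 + (1 + α) * R) / (1 + R) := by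
    rw [← hQR, div_le_div_iff₀ (by linarith) (by linarith)]
    have hQ0 : 0 < Q := Real.rpow_pos_of_pos hR _
    calc α * y ^ (2 - α / 2) * (1 + R) ≤ α * (y * Q) * (1 + R) := by gcongr; exact le y hy hyR
      _ ≤ α * R * Q * (1 + y) := by
        have := mul_le_mul_of_nonneg_left hyR.le (mul_pos h0 hQ0).le
        nlinarith
  have ex : (1 + (1 + α) * R) / (1 + R) ≤
      (2 + 2 * (1 + α) * x - α * x ^ (2 - α / 2)) / (1 + x) := by
    rw [div_le_div_iff₀ (by linarith) (by linarith)]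
    have e1 : α * x ^ (2 - α / 2) * R ≤ x * (1 + (1 + α) * R) := by
      rw [← hQR]
      have := mul_le_mul_of_nonneg_left (le x hx hxR) (mul_pos h0 hR).le
      linarith
    have e2 : α * x ^ (2 - α / 2) * (1 + R) * R ≤ x * (1 + (1 + α) * R) * (1 + R) := by
      have := mul_le_mul_of_nonneg_right e1 (show 0 ≤ 1 + R by linarith)
      linarith
    refine le_of_mul_le_mul_right ?_ hR
    -- the remaining inequality is linear in `x`, with equality at `x = R`
    have e3 : 0 ≤ (R - x) * (1 + R - α * R) := mul_nonneg (by linarith) (by nlinarith)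
    nlinarith
  rw [gFun]
  linarith

/-! ### Monotonicity of the modified kernels in time -/

theorem kerMod_one_of_lt {α : ℝ} {t : ℕ → ℝ} {n : ℕ} (hn : 1 < n) :
    kerMod α t n 1 = kerA α t n 1 - kerEta α t n 1 / (1 + ratio t 2) := by
  rw [kerMod, if_neg (by omega), kerHat, if_neg (by omega), if_neg (by omega), if_pos rfl]

theorem kerMod_of_lt {α : ℝ} {t : ℕ → ℝ} {n k : ℕ} (hk : 1 < k) (hkn : k < n) :
    kerMod α t n k = kerA α t n k - kerEta α t n k / (1 + ratio t (k + 1))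
      + kerEta α t n (k - 1) / (ratio t k * (1 + ratio t k)) := by
  rw [kerMod, if_neg (by omega), kerHat, if_neg (by omega), if_neg (by omega), if_neg (by omega)]

theorem kerMod_self {α : ℝ} {t : ℕ → ℝ} {n : ℕ} (hn : 1 < n) :
    kerMod α t n n = 2 * ((1 - α) / (2 - α) * kerA α t n n
      + kerEta α t n (n - 1) / (ratio t n * (1 + ratio t n))) := by
  rw [kerMod, if_pos rfl, kerHat, if_neg (by omega), if_pos rfl]

section Monotone

variable {α : ℝ} {N : ℕ} {t : ℕ → ℝ}

theorem kerA_sub (h1 : α < 1) (n n' k : ℕ) :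
    kerA α t n k - kerA α t n' k = mean (kerDrop α (t n) (t n')) (t (k - 1)) (t k) := by
  rw [kerA_eq_mean, kerA_eq_mean, ← mean_sub (intervalIntegrable_omega h1 _ _ _)
    (intervalIntegrable_omega h1 _ _ _)]
  rfl

theorem kerEta_sub (h1 : α < 1) (n n' k : ℕ) :
    kerEta α t n k - kerEta α t n' k = tilt (kerDrop α (t n) (t n')) (t (k - 1)) (t k) := by
  rw [kerEta_eq_tilt, kerEta_eq_tilt, ← tilt_sub (intervalIntegrable_omega h1 _ _ _)
    (intervalIntegrable_omega h1 _ _ _)]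
  rfl

theorem kerA_nonneg (h1 : α < 1) (ht : ∀ k, k ≤ N → t k < t (k + 1)) {n k : ℕ} (hk : 1 ≤ k)
    (hkn : k ≤ n) (hn : n ≤ N + 1) : 0 ≤ kerA α t n k :=
  mean_omega_nonneg h1 (mesh_lt ht (by omega) (by omega)) (mesh_le ht hkn hn)

theorem kerEta_nonneg (h0 : 0 < α) (h1 : α < 1) (ht : ∀ k, k ≤ N → t k < t (k + 1)) {n k : ℕ}
    (hk : 1 ≤ k) (hkn : k ≤ n) (hn : n ≤ N + 1) : 0 ≤ kerEta α t n k :=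
  tilt_omega_nonneg h0 h1 (mesh_lt ht (by omega) (by omega)) (mesh_le ht hkn hn)

theorem kerEta_le_kerA (h1 : α < 1) (ht : ∀ k, k ≤ N → t k < t (k + 1)) {n k : ℕ}
    (hk : 1 ≤ k) (hkn : k ≤ n) (hn : n ≤ N + 1) : kerEta α t n k ≤ kerA α t n k :=
  tilt_omega_le_mean h1 (mesh_lt ht (by omega) (by omega)) (mesh_le ht hkn hn)

/-- `a₀^{(n)} = τ_n^{-α} / Γ(2 - α)`. -/
theorem kerA_current (h1 : α < 1) (ht : ∀ k, k ≤ N → t k < t (k + 1)) {n : ℕ} (hn1 : 1 ≤ n)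
    (hn : n ≤ N + 1) :
    kerA α t n n = step t n ^ (-α) / ((1 - α) * Real.Gamma (1 - α)) :=
  mean_omega_current h1 (mesh_lt ht (by omega) hn)

theorem kerEta_current (h1 : α < 1) (ht : ∀ k, k ≤ N → t k < t (k + 1)) {n : ℕ} (hn1 : 1 ≤ n)
    (hn : n ≤ N + 1) : kerEta α t n n = α / (2 - α) * kerA α t n n :=
  tilt_omega_current h1 (mesh_lt ht (by omega) hn)

theorem kerA_current_pos (h1 : α < 1) (ht : ∀ k, k ≤ N → t k < t (k + 1)) {n : ℕ} (hn1 : 1 ≤ n)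
    (hn : n ≤ N + 1) : 0 < kerA α t n n := by
  rw [kerA_current h1 ht hn1 hn]
  exact div_pos (Real.rpow_pos_of_pos (step_pos ht hn1 hn) _)
    (mul_pos (by linarith) (Real.Gamma_pos_of_pos (by linarith)))

/-- The oldest modified kernel decreases in time. -/
theorem kerMod_succ_one_le (h0 : 0 < α) (h1 : α < 1) (ht : ∀ k, k ≤ N → t k < t (k + 1)) {n : ℕ}
    (hn : 1 ≤ n) (hnN : n ≤ N) : kerMod α t (n + 1) 1 ≤ kerMod α t n 1 := by
  have hT : t n < t (n + 1) := ht n hnN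
  have h01 : t (1 - 1) < t 1 := mesh_lt ht (by omega) (by omega)
  have hr : 0 < ratio t 2 := ratio_succ_pos ht le_rfl (by omega)
  rw [kerMod_one_of_lt (show 1 < n + 1 by omega)]
  have hpos : ∀ s ∈ Set.Ioo (t (1 - 1)) (t 1), 0 ≤ kerDrop α (t n) (t (n + 1)) s := fun s hs =>
    kerDrop_nonneg h0 h1 hT.le (hs.2.trans_le (mesh_le ht hn (by omega)))
  rcases hn.eq_or_lt with rfl | h
  · have e : kerMod α t 1 1 = 2 * kerA α t 1 1 := by simp [kerMod, kerHat]
    have h2 := mean_nonneg h01 (intervalIntegrable_kerDrop h1 _ _ _ _) hpos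
    rw [← kerA_sub h1] at h2
    have h3 : 0 ≤ kerEta α t (1 + 1) 1 / (1 + ratio t 2) :=
      div_nonneg (kerEta_nonneg h0 h1 ht le_rfl (by omega) (by omega)) (by linarith)
    have h4 := kerA_nonneg h1 ht (n := 1) (k := 1) le_rfl le_rfl (by omega)
    rw [e]
    linarith
  · rw [kerMod_one_of_lt h]
    have h2 := mean_sub_tilt_nonneg h01 (intervalIntegrable_kerDrop h1 _ _ _ _)
      (θ := 1 / (1 + ratio t 2)) (by positivity)
      (by rw [div_le_one (by linarith)]; linarith) hpos
    rw [← kerA_sub h1, ← kerEta_sub h1, one_div_mul_eq_div, sub_div] at h2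
    linarith

/-- The increments `A_{n-j-1} - A_{n-j}` of the modified kernels decrease in time. -/
theorem kerMod_succ_sub_le (h0 : 0 < α) (h1 : α < 1) (ht : ∀ k, k ≤ N → t k < t (k + 1))
    (hr : ∀ k, 2 ≤ k → k ≤ N + 1 → ratioLower ≤ ratio t k) {n j : ℕ} (hj : 1 ≤ j) (hjn : j < n)
    (hnN : n ≤ N) :
    kerMod α t (n + 1) (j + 1) - kerMod α t (n + 1) j
      ≤ kerMod α t n (j + 1) - kerMod α t n j := by
  have hT : t n < t (n + 1) := ht n hnN
  set ψ := kerDrop α (t n) (t (n + 1)) with hψ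
  have hlt : ∀ i j, i < j → j ≤ N + 1 → t i < t j := fun i j h h' => mesh_lt ht h h'
  have hle : ∀ i j, i ≤ j → j ≤ N + 1 → t i ≤ t j := fun i j h h' => mesh_le ht h h'
  have rpos : ∀ k, 2 ≤ k → k ≤ N + 1 → 0 < ratio t k := fun k h h' => ratio_pos ht h h'
  have hint := intervalIntegrable_kerDrop h1 (t n) (t (n + 1))
  have hρ := rpos (j + 1) (by omega) (by omega)
  have dEj : 0 ≤ kerEta α t n j - kerEta α t (n + 1) j := by
    rw [kerEta_sub h1]
    refine tilt_nonneg (hlt _ _ (by omega) (by omega)) (hint _ _)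
      ((monotoneOn_kerDrop h0 h1 hT.le).mono fun s hs => ?_)
    exact hs.2.trans_le (hle _ _ (by omega) (by omega))
  have extra : 0 ≤ (kerEta α t n j - kerEta α t (n + 1) j)
        / (ratio t (j + 1) * (1 + ratio t (j + 1)))
      + (kerEta α t n j - kerEta α t (n + 1) j) / (1 + ratio t (j + 1)) := by positivity
  -- the kernel with index `j` drops by at most `ψ (t j)`
  have lower : kerMod α t n j + kerEta α t n j / (1 + ratio t (j + 1))
      - (kerMod α t (n + 1) j + kerEta α t (n + 1) j / (1 + ratio t (j + 1))) ≤ ψ (t j) := by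
    rcases hj.eq_or_lt with rfl | hj1
    · rw [kerMod_one_of_lt hjn, kerMod_one_of_lt (show 1 < n + 1 by omega)]
      have := mean_kerDrop_le h0 h1 hT.le (hlt (1 - 1) 1 (by omega) (by omega))
        (hlt 1 n hjn (by omega))
      rw [← kerA_sub h1] at this
      linarith
    · rw [kerMod_of_lt hj1 hjn, kerMod_of_lt hj1 (show j < n + 1 by omega)]
      have hrj := rpos j hj1 (by omega)
      obtain ⟨i, rfl⟩ := Nat.exists_eq_add_of_le' (show 1 ≤ j by omega)
      have hsi := step_pos ht (k := i) (by omega) (by omega)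
      have := mean_add_tilt_kerDrop_le h0 h1 hT.le (x₀ := t (i - 1)) (x₁ := t i) (x₂ := t (i + 1))
        (ρ := 1 / (ratio t (i + 1) * (1 + ratio t (i + 1)))) (hlt _ _ (by omega) (by omega))
        (hlt _ _ (by omega) (by omega)) (hlt _ _ hjn (by omega)) (by positivity) (by
          change _ * step t i ≤ 3 * (t (i + 1) - t (i + 1 - 1))
          change _ * step t i ≤ 3 * step t (i + 1)
          have h3 := one_le_of_ratioLower_le (hr (i + 1) hj1 (by omega))
          have h4 : step t (i + 1) = ratio t (i + 1) * step t i := by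
            rw [ratio_succ (by omega)]; field_simp
          rw [h4, one_div_mul_eq_div, div_le_iff₀ (by positivity)]
          nlinarith)
      have e1 := kerA_sub (t := t) h1 n (n + 1) (i + 1)
      have e2 := kerEta_sub (t := t) h1 n (n + 1) i
      rw [Nat.add_sub_cancel] at e1 ⊢
      rw [← e1, ← e2, one_div_mul_eq_div, sub_div] at this
      linarith
  -- the kernel with index `j + 1` drops by at least `ψ (t j)`
  have upper : ψ (t j) + kerEta α t n j / (ratio t (j + 1) * (1 + ratio t (j + 1)))
      - kerEta α t (n + 1) j / (ratio t (j + 1) * (1 + ratio t (j + 1)))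
      ≤ kerMod α t n (j + 1) - kerMod α t (n + 1) (j + 1) := by
    have hjr := rpos (j + 2) (by omega) (by omega)
    rw [kerMod_of_lt (show 1 < j + 1 by omega) (show j + 1 < n + 1 by omega), Nat.add_sub_cancel]
    rcases (show j + 1 ≤ n from hjn).eq_or_lt with rfl | hj2
    · rw [kerMod_self (by omega), Nat.add_sub_cancel]
      have h2 := kerDrop_le_current h0 h1 (hlt j (j + 1) (by omega) (by omega)) hT
      have e : (t (j + 1 + 1) - t (j + 1)) / (t (j + 1) - t j) = ratio t (j + 1 + 1) := by
        rw [ratio_succ (by omega)]; rfl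
      rw [e] at h2
      change ψ (t j) ≤ 2 * ((1 - α) / (2 - α) * kerA α t (j + 1) (j + 1))
        - (kerA α t (j + 1 + 1) (j + 1)
          - kerEta α t (j + 1 + 1) (j + 1) / (1 + ratio t (j + 1 + 1))) at h2
      have h3 : 0 ≤ kerEta α t (j + 1) j / (ratio t (j + 1) * (1 + ratio t (j + 1))) :=
        div_nonneg (kerEta_nonneg h0 h1 ht hj (by omega) (by omega)) (by positivity)
      linarith
    · rw [kerMod_of_lt (show 1 < j + 1 by omega) hj2, Nat.add_sub_cancel]
      have h2 := le_mean_sub_tilt (hlt j (j + 1) (by omega) (by omega)) (hint _ _)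
        (θ := 1 / (1 + ratio t (j + 1 + 1))) (c := ψ (t j)) (by positivity)
        (by rw [div_le_one (by linarith)]; linarith) fun s hs => by
          have hs' : s < t n := hs.2.trans_le (hle _ _ (by omega) (by omega))
          exact monotoneOn_kerDrop h0 h1 hT.le (show t j < t n from hs.1.trans hs') hs' hs.1.le
      have e1 := kerA_sub (t := t) h1 n (n + 1) (j + 1)
      have e2 := kerEta_sub (t := t) h1 n (n + 1) (j + 1)
      rw [Nat.add_sub_cancel] at e1 e2
      rw [← e1, ← e2, one_div_mul_eq_div, sub_div] at h2
      linarith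
  rw [sub_div, sub_div] at extra
  linarith

end Monotone

/-! ### The FBDF2 formula as a convolution -/

theorem quadInterp_derivative_eval {t : ℕ → ℝ} (v : ℕ → ℝ) {k : ℕ} (hk : 1 ≤ k)
    (h1 : t (k - 1) < t k) (h2 : t k < t (k + 1)) (s : ℝ) :
    (quadInterp t v k).derivative.eval s = (v k - v (k - 1)) / step t k
      + ((v (k + 1) - v k) / step t (k + 1) - (v k - v (k - 1)) / step t k)
        / (step t k + step t (k + 1)) * (2 * (s - (t k + t (k - 1)) / 2)) := by
  obtain ⟨k, rfl⟩ := Nat.exists_eq_add_of_le' hk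
  simp only [step, Nat.add_sub_cancel] at *
  set d := (v (k + 1) - v k) / (t (k + 1) - t k)
  set e := ((v (k + 1 + 1) - v (k + 1)) / (t (k + 1 + 1) - t (k + 1)) - d)
    / (t (k + 1) - t k + (t (k + 1 + 1) - t (k + 1))) with he
  have hset : Finset.Icc k (k + 1 + 1) = {k, k + 1, k + 1 + 1} := by
    ext i; simp only [Finset.mem_Icc, Finset.mem_insert, Finset.mem_singleton]; omega
  open Polynomial in
  set P : ℝ[X] := C (v k) + C d * (X - C (t k)) + C e * ((X - C (t k)) * (X - C (t (k + 1))))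
    with hP
  have hPeq : P = quadInterp t v (k + 1) := by
    rw [quadInterp, Nat.add_sub_cancel]
    refine Lagrange.eq_interpolate_of_eval_eq _ ?_ ?_ ?_
    · rw [hset]
      intro i hi j hj hij
      simp only [Finset.coe_insert, Finset.coe_singleton, Set.mem_insert_iff,
        Set.mem_singleton_iff] at hi hj
      rcases hi with rfl | rfl | rfl <;> rcases hj with rfl | rfl | rfl <;>
        first | rfl | (exfalso; linarith)
    · rw [Nat.card_Icc, show k + 1 + 1 + 1 - k = 3 by omega]
      have : P.degree ≤ 2 := by rw [hP]; compute_degree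
      exact this.trans_lt (by norm_num)
    · have n1 : t (k + 1) - t k ≠ 0 := by linarith
      have n2 : t (k + 1 + 1) - t (k + 1) ≠ 0 := by linarith
      have n3 : t (k + 1) - t k + (t (k + 1 + 1) - t (k + 1)) ≠ 0 := by linarith
      have hd : d * (t (k + 1) - t k) = v (k + 1) - v k := div_mul_cancel₀ _ n1
      have he' : e * (t (k + 1) - t k + (t (k + 1 + 1) - t (k + 1)))
          * (t (k + 1 + 1) - t (k + 1)) = v (k + 1 + 1) - v (k + 1)
            - d * (t (k + 1 + 1) - t (k + 1)) := by
        rw [he, div_mul_cancel₀ _ n3, sub_mul, div_mul_cancel₀ _ n2]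
      intro i hi
      rw [hset] at hi
      simp only [Finset.mem_insert, Finset.mem_singleton] at hi
      rcases hi with rfl | rfl | rfl
      · simp [hP]
      · simp only [hP, Polynomial.eval_add, Polynomial.eval_mul, Polynomial.eval_sub,
          Polynomial.eval_C, Polynomial.eval_X]
        linear_combination hd
      · simp only [hP, Polynomial.eval_add, Polynomial.eval_mul, Polynomial.eval_sub,
          Polynomial.eval_C, Polynomial.eval_X]
        linear_combination hd + he'
  rw [← hPeq, hP]
  simp only [Polynomial.derivative_add, Polynomial.derivative_mul, Polynomial.derivative_sub,
    Polynomial.derivative_C, Polynomial.derivative_X, Polynomial.eval_add, Polynomial.eval_mul,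
    Polynomial.eval_sub, Polynomial.eval_C, Polynomial.eval_X, Polynomial.eval_one,
    Polynomial.eval_zero]
  ring

section Convolution

variable {α : ℝ} {N : ℕ} {t : ℕ → ℝ}

theorem integral_omega_mul_affine (h1 : α < 1) (ht : ∀ k, k ≤ N → t k < t (k + 1)) (n : ℕ) {k : ℕ}
    (hk : 1 ≤ k) (hkN : k ≤ N + 1) (p q : ℝ) :
    ∫ s in t (k - 1)..t k, omega (1 - α) (t n - s) * (p + q * (2 * (s - (t k + t (k - 1)) / 2)))
      = p * step t k * kerA α t n k + q * step t k ^ 2 * kerEta α t n k := by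
  have hs := (step_pos ht hk hkN).ne'
  have io := intervalIntegrable_omega h1 (t n) (t (k - 1)) (t k)
  have e : ∀ s, omega (1 - α) (t n - s) * (p + q * (2 * (s - (t k + t (k - 1)) / 2)))
      = p * omega (1 - α) (t n - s) + q * 2 * step t k
        * ((s - (t k + t (k - 1)) / 2) / step t k * omega (1 - α) (t n - s)) := by
    intro s; field_simp
  simp only [e]
  rw [intervalIntegral.integral_add (io.const_mul _)
      ((io.continuousOn_mul (by fun_prop)).const_mul _),
    intervalIntegral.integral_const_mul, intervalIntegral.integral_const_mul, kerA, kerEta]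
  field_simp

/-- Regrouping a sum over intervals by the index of the increment. -/
theorem sum_mul_add_shift (X Z H D : ℕ → ℝ) {m : ℕ} (hm : 1 ≤ m) (h1 : H 1 = X 1)
    (hH : ∀ k, 1 ≤ k → k < m → H (k + 1) = X (k + 1) + Z k) :
    ∑ k ∈ Finset.Icc 1 m, (X k * D k + Z k * D (k + 1))
      = ∑ k ∈ Finset.Icc 1 m, H k * D k + Z m * D (m + 1) := by
  induction m, hm using Nat.le_induction with
  | base => simp [h1]
  | succ m hm ih =>
    rw [Finset.sum_Icc_succ_top (by omega), Finset.sum_Icc_succ_top (by omega),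
      ih fun k hk hkm => hH k hk (by omega), hH m hm (by omega)]
    ring

theorem gamma_three_sub (h1 : α < 1) :
    Real.Gamma (3 - α) = (2 - α) * ((1 - α) * Real.Gamma (1 - α)) := by
  rw [show 3 - α = (1 - α + 1) + 1 by ring, Real.Gamma_add_one (by linarith),
    Real.Gamma_add_one (by linarith)]
  ring

/-- The FBDF2 formula is the sum of a BDF2-like local part and a convolution with the kernels
`â_{n-k}^{(n)}`. -/
theorem fbdf2_succ (h0 : 0 < α) (h1 : α < 1) (ht : ∀ k, k ≤ N → t k < t (k + 1)) {m : ℕ}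
    (hm : 1 ≤ m) (hmN : m ≤ N) (v : ℕ → ℝ) :
    fbdf2 α t v (m + 1)
      = 1 / (Real.Gamma (3 - α) * step t (m + 1) ^ α)
          * ((1 + (1 + α) * ratio t (m + 1)) / (1 + ratio t (m + 1)) * (v (m + 1) - v m)
            - α * ratio t (m + 1) ^ 2 / (1 + ratio t (m + 1)) * (v m - v (m - 1)))
        + ∑ k ∈ Finset.Icc 1 (m + 1), kerHat α t (m + 1) k * (v k - v (k - 1)) := by
  have stp : ∀ k, 1 ≤ k → k ≤ N + 1 → 0 < step t k := fun k h h' => step_pos ht h h'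
  have rp : ∀ k, 1 ≤ k → k ≤ N → 0 < ratio t (k + 1) := fun k h h' => ratio_succ_pos ht h h'
  have hstep : ∀ k, 1 ≤ k → k ≤ N → step t (k + 1) = ratio t (k + 1) * step t k := by
    intro k hk hk'
    have := (stp k hk (by omega)).ne'
    rw [ratio_succ hk]; field_simp
  have hG : 0 < Real.Gamma (1 - α) := Real.Gamma_pos_of_pos (by linarith)
  have hα : 0 < 1 - α := by linarith
  have hα2 : 0 < 2 - α := by linarith
  set n := m + 1 with hn
  set D : ℕ → ℝ := fun k => v k - v (k - 1) with hD
  have terms : ∀ k ∈ Finset.Icc 1 m,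
      (∫ s in t (k - 1)..t k, omega (1 - α) (t n - s) * (quadInterp t v k).derivative.eval s)
        = (kerA α t n k - kerEta α t n k / (1 + ratio t (k + 1))) * D k
          + kerEta α t n k / (ratio t (k + 1) * (1 + ratio t (k + 1))) * D (k + 1) := by
    intro k hk
    rw [Finset.mem_Icc] at hk
    have hk1 := stp k hk.1 (by omega)
    have hr := rp k hk.1 (by omega)
    simp only [quadInterp_derivative_eval v hk.1 (mesh_lt ht (by omega) (by omega))
      (ht k (by omega))]
    rw [integral_omega_mul_affine h1 ht n hk.1 (by omega), hstep k hk.1 (by omega)]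
    simp only [hD, Nat.add_sub_cancel]
    field_simp
    ring
  have hmm := stp m hm (by omega)
  have hrm := rp m hm (by omega)
  have last : (∫ s in t (n - 1)..t n,
      omega (1 - α) (t n - s) * (quadInterp t v (n - 1)).derivative.eval s)
        = kerA α t n n * D n + kerEta α t n n * (ratio t n / (1 + ratio t n))
          * (D n - ratio t n * D m) := by
    -- the quadratic through the last three nodes, expanded about the midpoint of the last interval
    have e : ∀ s, (quadInterp t v (n - 1)).derivative.eval s
        = (v n - v m) / step t n + ((v n - v m) / step t n - (v m - v (m - 1)) / step t m)
          / (step t m + step t n) * (2 * (s - (t n + t (n - 1)) / 2)) := by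
      intro s
      simp only [hn, Nat.add_sub_cancel]
      rw [quadInterp_derivative_eval v hm (mesh_lt ht (by omega) (by omega)) (ht m hmN)]
      have s1 := stp (m + 1) (by omega) (by omega)
      have hsum : (t (m + 1) - t (m - 1)) = step t m + step t (m + 1) := by
        simp [step]
      have hpos : step t m + step t (m + 1) ≠ 0 := by positivity
      set e := ((v (m + 1) - v m) / step t (m + 1) - (v m - v (m - 1)) / step t m)
        / (step t m + step t (m + 1)) with he
      have : e * (t (m + 1) - t (m - 1))
          = (v (m + 1) - v m) / step t (m + 1) - (v m - v (m - 1)) / step t m := by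
        rw [hsum, he, div_mul_cancel₀ _ hpos]
      linear_combination this
    simp only [e]
    rw [integral_omega_mul_affine h1 ht n (by omega) (by omega), hn, hstep m hm (by omega)]
    simp only [hD, Nat.add_sub_cancel]
    field_simp
  have hhat1 : kerHat α t n 1 = kerA α t n 1 - kerEta α t n 1 / (1 + ratio t (1 + 1)) := by
    rw [kerHat, if_neg (by omega), if_neg (by omega), if_pos rfl]
  have hhat : ∀ k, 1 ≤ k → k < m → kerHat α t n (k + 1)
      = (kerA α t n (k + 1) - kerEta α t n (k + 1) / (1 + ratio t (k + 1 + 1)))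
        + kerEta α t n k / (ratio t (k + 1) * (1 + ratio t (k + 1))) := by
    intro k hk hkm
    rw [kerHat, if_neg (by omega), if_neg (by omega), if_neg (by omega), Nat.add_sub_cancel]
  have hhatn : kerHat α t n n = (1 - α) / (2 - α) * kerA α t n n
      + kerEta α t n m / (ratio t n * (1 + ratio t n)) := by
    rw [kerHat, if_neg (by omega), if_pos rfl, hn, Nat.add_sub_cancel]
  rw [fbdf2, if_neg (by omega), last, show n - 1 = m by omega, Finset.sum_congr rfl terms,
    sum_mul_add_shift _ (fun k => kerEta α t n k / (ratio t (k + 1) * (1 + ratio t (k + 1))))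
      (kerHat α t n) D hm hhat1 hhat, hn, Finset.sum_Icc_succ_top (by omega), ← hn, hhatn,
    kerEta_current h1 ht (by omega) (by omega)]
  have hA : kerA α t n n = (2 - α) * (1 / (Real.Gamma (3 - α) * step t n ^ α)) := by
    rw [kerA_current h1 ht (by omega) (by omega), gamma_three_sub h1,
      Real.rpow_neg (stp n (by omega) (by omega)).le]
    field_simp
  rw [hA]
  have hDn : v n - v m = D n := rfl
  have hDm : v m - v (m - 1) = D m := rfl
  rw [hDn, hDm]
  change _ = _ + (∑ k ∈ Finset.Icc 1 m, kerHat α t n k * D k + _ * D n)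
  have hrn : 0 < ratio t n := hrm
  generalize 1 / (Real.Gamma (3 - α) * step t n ^ α) = c
  field_simp
  ring

/-- The leading coefficient of the FBDF2 formula is positive, so each increment is determined by
the discrete derivative and the previous increments. -/
theorem exists_fbdf2_eq_sum (h0 : 0 < α) (h1 : α < 1) (ht : ∀ k, k ≤ N → t k < t (k + 1)) {n : ℕ}
    (hn : 1 ≤ n) (hnN : n ≤ N) :
    ∃ (b : ℝ) (c : ℕ → ℝ), 0 < b ∧ ∀ v : ℕ → ℝ, fbdf2 α t v n
      = b * (v n - v (n - 1)) + ∑ k ∈ Finset.Icc 1 (n - 1), c k * (v k - v (k - 1)) := by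
  rcases hn.eq_or_lt with rfl | h
  · refine ⟨kerA α t 1 1, 0, kerA_current_pos h1 ht le_rfl (by omega), fun v => ?_⟩
    simp [fbdf2]
  obtain ⟨m, rfl⟩ := Nat.exists_eq_add_of_le' hn
  have hm : 1 ≤ m := by omega
  have hr := ratio_succ_pos ht hm (by omega)
  have hG : 0 < Real.Gamma (3 - α) := Real.Gamma_pos_of_pos (by linarith)
  have hs := Real.rpow_pos_of_pos (step_pos ht (show 1 ≤ m + 1 by omega) (by omega)) α
  set r := ratio t (m + 1)
  set g := 1 / (Real.Gamma (3 - α) * step t (m + 1) ^ α) with hg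
  have hgpos : 0 < g := by positivity
  refine ⟨g * ((1 + (1 + α) * r) / (1 + r)) + kerHat α t (m + 1) (m + 1),
    fun k => kerHat α t (m + 1) k + if k = m then -(g * (α * r ^ 2 / (1 + r))) else 0, ?_,
    fun v => ?_⟩
  · have : 0 ≤ kerHat α t (m + 1) (m + 1) := by
      rw [kerHat, if_neg (by omega), if_pos rfl, Nat.add_sub_cancel]
      have h3 := kerA_nonneg (k := m + 1) h1 ht (by omega) le_rfl (by omega)
      have h4 := kerEta_nonneg (k := m) (n := m + 1) h0 h1 ht (by omega) (by omega) (by omega)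
      have h5 : 0 < 1 - α := by linarith
      have h6 : 0 < 2 - α := by linarith
      have h7 : 0 < r * (1 + r) := by positivity
      exact add_nonneg (mul_nonneg (div_pos h5 h6).le h3) (div_nonneg h4 h7.le)
    positivity
  · rw [fbdf2_succ h0 h1 ht hm (by omega), Finset.sum_Icc_succ_top (by omega), Nat.add_sub_cancel]
    have : ∑ k ∈ Finset.Icc 1 m, (kerHat α t (m + 1) k
        + if k = m then -(g * (α * r ^ 2 / (1 + r))) else 0) * (v k - v (k - 1))
        = ∑ k ∈ Finset.Icc 1 m, kerHat α t (m + 1) k * (v k - v (k - 1))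
          - g * (α * r ^ 2 / (1 + r)) * (v m - v (m - 1)) := by
      simp only [add_mul, Finset.sum_add_distrib, ite_mul, zero_mul]
      rw [Finset.sum_ite_eq' , if_pos (Finset.mem_Icc.mpr ⟨hm, le_rfl⟩)]
      ring
    rw [this]
    ring

end Convolution

/-! ### The limit of integer order -/

theorem tendsto_omega_zero {x : ℝ} (hx : 0 < x) :
    Tendsto (fun β : ℝ => omega (1 - β) x) (𝓝[<] 1) (𝓝 0) := by
  have h : ∀ᶠ β : ℝ in 𝓝[<] 1, (1 - β) * x ^ (-β) / Real.Gamma (2 - β) = omega (1 - β) x := by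
    filter_upwards [self_mem_nhdsWithin] with β hβ
    have hβ' : 0 < 1 - β := sub_pos.mpr hβ
    rw [omega, show 2 - β = 1 - β + 1 by ring, Real.Gamma_add_one hβ'.ne',
      show 1 - β - 1 = -β by ring, mul_div_mul_left _ _ hβ'.ne']
  refine Tendsto.congr' h (tendsto_nhdsWithin_of_tendsto_nhds ?_)
  have hG : ContinuousAt Real.Gamma (2 - 1) := by
    refine (Real.differentiableAt_Gamma fun m => ?_).continuousAt
    have : (0 : ℝ) ≤ m := m.cast_nonneg
    linarith
  have hc : ContinuousAt (fun β : ℝ => (1 - β) * x ^ (-β) / Real.Gamma (2 - β)) 1 := by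
    refine ContinuousAt.div (ContinuousAt.mul (by fun_prop) ?_)
      (ContinuousAt.comp (f := fun β : ℝ => 2 - β) hG (by fun_prop))
      (Real.Gamma_pos_of_pos (by norm_num)).ne'
    exact continuousAt_const.rpow (by fun_prop) (Or.inl hx.ne')
  simpa [ContinuousAt] using hc

section Limit

variable {N : ℕ} {t : ℕ → ℝ}

theorem eventually_mem_Ioo_zero_one : ∀ᶠ β : ℝ in 𝓝[<] 1, 0 < β ∧ β < 1 :=
  Ioo_mem_nhdsLT zero_lt_one

theorem tendsto_kerA (ht : ∀ k, k ≤ N → t k < t (k + 1)) {n k : ℕ} (hk : 1 ≤ k) (hkn : k < n)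
    (hn : n ≤ N + 1) : Tendsto (fun β => kerA β t n k) (𝓝[<] 1) (𝓝 0) := by
  have hkt := mesh_lt ht hkn hn
  refine tendsto_of_tendsto_of_tendsto_of_le_of_le' tendsto_const_nhds
    (tendsto_omega_zero (sub_pos.mpr hkt)) ?_ ?_
  · filter_upwards [eventually_mem_Ioo_zero_one] with β hβ
    exact kerA_nonneg hβ.2 ht hk hkn.le hn
  · filter_upwards [eventually_mem_Ioo_zero_one] with β hβ
    exact mean_omega_le hβ.1 hβ.2 (mesh_lt ht (by omega) (by omega)) hkt

theorem tendsto_kerEta (ht : ∀ k, k ≤ N → t k < t (k + 1)) {n k : ℕ} (hk : 1 ≤ k) (hkn : k < n)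
    (hn : n ≤ N + 1) : Tendsto (fun β => kerEta β t n k) (𝓝[<] 1) (𝓝 0) := by
  refine tendsto_of_tendsto_of_tendsto_of_le_of_le' tendsto_const_nhds
    (tendsto_kerA ht hk hkn hn) ?_ ?_
  · filter_upwards [eventually_mem_Ioo_zero_one] with β hβ
    exact kerEta_nonneg hβ.1 hβ.2 ht hk hkn.le hn
  · filter_upwards [eventually_mem_Ioo_zero_one] with β hβ
    exact kerEta_le_kerA hβ.2 ht hk hkn.le hn

theorem tendsto_kerA_current (ht : ∀ k, k ≤ N → t k < t (k + 1)) {n : ℕ} (hn1 : 1 ≤ n)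
    (hn : n ≤ N + 1) :
    Tendsto (fun β => (1 - β) / (2 - β) * kerA β t n n) (𝓝[<] 1) (𝓝 0) := by
  have hs := step_pos ht hn1 hn
  have h : ∀ᶠ β : ℝ in 𝓝[<] 1,
      omega (1 - β) (step t n) / (2 - β) = (1 - β) / (2 - β) * kerA β t n n := by
    filter_upwards [eventually_mem_Ioo_zero_one] with β hβ
    have hG := Real.Gamma_pos_of_pos (show 0 < 1 - β by linarith)
    have h2 : 0 < 2 - β := by linarith
    have h1 : 0 < 1 - β := by linarith
    rw [kerA_current hβ.2 ht hn1 hn, omega, show 1 - β - 1 = -β by ring]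
    field_simp
  refine Tendsto.congr' h ?_
  have h2 : Tendsto (fun β : ℝ => 2 - β) (𝓝[<] 1) (𝓝 (2 - 1)) :=
    tendsto_nhdsWithin_of_tendsto_nhds (Continuous.tendsto (by fun_prop) 1)
  have := (tendsto_omega_zero hs).div h2 (by norm_num)
  rw [zero_div] at this
  exact this

/-- All modified kernels vanish as the order tends to `1`. -/
theorem tendsto_kerMod (ht : ∀ k, k ≤ N → t k < t (k + 1)) {n k : ℕ} (hn : 1 < n) (hk : 1 ≤ k)
    (hkn : k ≤ n) (hnN : n ≤ N + 1) : Tendsto (fun β => kerMod β t n k) (𝓝[<] 1) (𝓝 0) := by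
  rcases hkn.eq_or_lt with rfl | h
  · simp only [kerMod_self hn]
    simpa using ((tendsto_kerA_current ht hk hnN).add ((tendsto_kerEta ht (k := k - 1) (n := k)
      (by omega) (by omega) hnN).div_const (ratio t k * (1 + ratio t k)))).const_mul 2
  rcases hk.eq_or_lt with rfl | hk1
  · simp only [kerMod_one_of_lt hn]
    simpa using (tendsto_kerA ht le_rfl h hnN).sub
      ((tendsto_kerEta ht le_rfl h hnN).div_const (1 + ratio t 2))
  · simp only [kerMod_of_lt hk1 h]
    simpa using ((tendsto_kerA ht hk h hnN).sub
      ((tendsto_kerEta ht hk h hnN).div_const (1 + ratio t (k + 1)))).add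
      ((tendsto_kerEta ht (k := k - 1) (n := n) (by omega) (by omega) hnN).div_const
        (ratio t k * (1 + ratio t k)))

end Limit

/-! ### Weak gradients -/

theorem continuous_gradient {ψ : Plane → ℝ} (hψ : ContDiff ℝ ∞ ψ) : Continuous (gradient ψ) :=
  (InnerProductSpace.toDual ℝ Plane).symm.continuous.comp (hψ.continuous_fderiv (by simp))

theorem gradient_eq_zero_of_notMem {ψ : Plane → ℝ} {x : Plane} (hx : x ∉ tsupport ψ) :
    gradient ψ x = 0 := by
  have : fderiv ℝ ψ x = 0 := by
    by_contra h
    exact hx (support_fderiv_subset ℝ h)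
  rw [gradient, this, map_zero]

section WeakGrad

variable {U : Set Plane}

theorem integrableOn_smul_gradient (hU : IsOpen U) {u : Plane → ℝ}
    (hu : LocallyIntegrableOn u U volume) {ψ : Plane → ℝ} (hψ : ContDiff ℝ ∞ ψ)
    (hc : HasCompactSupport ψ) (hs : tsupport ψ ⊆ U) :
    IntegrableOn (fun x => u x • gradient ψ x) U volume :=
  ((hu.integrableOn_compact_subset hs hc).smul_continuousOn
    (continuous_gradient hψ).continuousOn hc).of_forall_sdiff_eq_zero hU.measurableSet
    fun x hx => by rw [gradient_eq_zero_of_notMem hx.2, smul_zero]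

theorem integrableOn_smul_of_tsupport_subset (hU : IsOpen U) {g : Plane → Plane}
    (hg : LocallyIntegrableOn g U volume) {ψ : Plane → ℝ} (hψ : ContDiff ℝ ∞ ψ)
    (hc : HasCompactSupport ψ) (hs : tsupport ψ ⊆ U) :
    IntegrableOn (fun x => ψ x • g x) U volume :=
  ((hg.integrableOn_compact_subset hs hc).continuousOn_smul
    hψ.continuous.continuousOn hc).of_forall_sdiff_eq_zero hU.measurableSet
    fun x hx => by rw [image_eq_zero_of_notMem_tsupport hx.2, zero_smul]

theorem HasWeakGrad.add (hU : IsOpen U) {u v : Plane → ℝ} {g h : Plane → Plane}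
    (hu : HasWeakGrad U u g) (hv : HasWeakGrad U v h) : HasWeakGrad U (u + v) (g + h) := by
  refine ⟨hu.1.add hv.1, hu.2.1.add hv.2.1, fun ψ h1 h2 h3 => ?_⟩
  simp only [Pi.add_apply, add_smul, smul_add]
  rw [integral_add (integrableOn_smul_gradient hU hu.1 h1 h2 h3)
      (integrableOn_smul_gradient hU hv.1 h1 h2 h3),
    integral_add (integrableOn_smul_of_tsupport_subset hU hu.2.1 h1 h2 h3)
      (integrableOn_smul_of_tsupport_subset hU hv.2.1 h1 h2 h3),
    hu.2.2 ψ h1 h2 h3, hv.2.2 ψ h1 h2 h3, neg_add]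

theorem HasWeakGrad.const_smul {u : Plane → ℝ} {g : Plane → Plane}
    (hu : HasWeakGrad U u g) (c : ℝ) : HasWeakGrad U (c • u) (c • g) := by
  refine ⟨hu.1.smul c, hu.2.1.smul c, fun ψ h1 h2 h3 => ?_⟩
  simp only [Pi.smul_apply, smul_assoc, smul_comm _ c]
  rw [integral_smul, integral_smul, hu.2.2 ψ h1 h2 h3, smul_neg]

theorem integral_gradient_eq_zero {ψ : Plane → ℝ} (hψ : ContDiff ℝ ∞ ψ)
    (hc : HasCompactSupport ψ) : ∫ x, gradient ψ x = 0 := by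
  have hi : Integrable (gradient ψ) := (continuous_gradient hψ).integrable_of_hasCompactSupport
    (HasCompactSupport.intro hc fun x hx => gradient_eq_zero_of_notMem hx)
  refine ext_inner_left ℝ fun v => ?_
  rw [inner_zero_right, ← integral_inner hi]
  have e : ∀ x, inner ℝ v (gradient ψ x) = fderiv ℝ ψ x v := fun x => by
    rw [real_inner_comm, gradient, InnerProductSpace.toDual_symm_apply]
  have hd : Differentiable ℝ ψ := hψ.differentiable (by simp)
  have := integral_mul_fderiv_eq_neg_fderiv_mul_of_integrable (μ := (volume : Measure Plane))
    (f := fun _ => (1 : ℝ)) (g := ψ) (v := v) (by simp)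
    (by simpa only [one_mul, ← e] using hi.const_inner v)
    (by simpa using hψ.continuous.integrable_of_hasCompactSupport hc)
    (fun x _ => by fun_prop) (fun x _ => hd x)
  simpa [e] using this

theorem hasWeakGrad_const (c : ℝ) : HasWeakGrad U (fun _ => c) 0 := by
  refine ⟨(locallyIntegrable_const c).locallyIntegrableOn U,
    (locallyIntegrable_const (0 : Plane)).locallyIntegrableOn U, fun ψ h1 h2 h3 => ?_⟩
  rw [integral_smul, setIntegral_eq_integral_of_forall_compl_eq_zero fun x hx =>
    gradient_eq_zero_of_notMem fun h => hx (h3 h), integral_gradient_eq_zero h1 h2]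
  simp

theorem HasWeakGrad.unique (hU : IsOpen U) {u : Plane → ℝ} {g h : Plane → Plane}
    (hg : HasWeakGrad U u g) (hh : HasWeakGrad U u h) : ∀ᵐ x, x ∈ U → g x = h x := by
  have := hU.ae_eq_zero_of_integral_contDiff_smul_eq_zero (hg.2.1.sub hh.2.1)
    (fun ψ h1 h2 h3 => ?_)
  · filter_upwards [this] with x hx hxU using sub_eq_zero.mp (hx hxU)
  · rw [← setIntegral_eq_integral_of_forall_compl_eq_zero (s := U) fun x hx => by
      rw [image_eq_zero_of_notMem_tsupport fun h => hx (h3 h), zero_smul]]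
    simp only [Pi.sub_apply, smul_sub]
    rw [integral_sub (integrableOn_smul_of_tsupport_subset hU hg.2.1 h1 h2 h3)
      (integrableOn_smul_of_tsupport_subset hU hh.2.1 h1 h2 h3), sub_eq_zero]
    exact neg_injective ((hg.2.2 ψ h1 h2 h3).symm.trans (hh.2.2 ψ h1 h2 h3))

end WeakGrad

/-! ### The Dirichlet form on `H¹` -/

variable {D : SpatialDomain}

theorem SpatialDomain.Admissible.isOpen_ambient (hD : D.Admissible) : IsOpen D.ambient := by
  cases D with
  | neumann Ω => exact hD.1
  | periodic L => exact isOpen_univ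

theorem SpatialDomain.Admissible.isOpen_region (hD : D.Admissible) : IsOpen D.region := by
  cases D with
  | neumann Ω => exact hD.1
  | periodic L =>
    simp only [SpatialDomain.region, Set.ofPred_forall]
    exact isOpen_iInter_of_finite fun i => (isOpen_lt (by fun_prop) (by fun_prop)).and
      (isOpen_lt (by fun_prop) (by fun_prop))

theorem SpatialDomain.region_subset_ambient : D.region ⊆ D.ambient := by
  cases D with
  | neumann Ω => exact subset_rfl
  | periodic L => exact Set.subset_univ _

theorem SpatialDomain.Admissible.isFiniteMeasure_vol (hD : D.Admissible) :
    IsFiniteMeasure (vol D) := by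
  refine ⟨?_⟩
  rw [vol, Measure.restrict_apply_univ]
  cases D with
  | neumann Ω => exact hD.2.2.measure_lt_top
  | periodic L =>
    have hK : IsCompact (WithLp.toLp 2 '' Set.Icc (0 : Fin 2 → ℝ) L : Set Plane) :=
      isCompact_Icc.image (PiLp.continuous_toLp 2 _)
    refine (measure_mono fun x hx => ?_).trans_lt hK.measure_lt_top
    exact ⟨x.ofLp, ⟨fun i => (hx i).1.le, fun i => (hx i).2.le⟩, rfl⟩

theorem SpatialDomain.Compatible.add {u v : Plane → ℝ} (hu : D.Compatible u)
    (hv : D.Compatible v) : D.Compatible (u + v) := by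
  cases D with
  | neumann Ω => trivial
  | periodic L => exact fun x i => by simp only [Pi.add_apply, hu x i, hv x i]

theorem SpatialDomain.Compatible.const_smul {u : Plane → ℝ} (hu : D.Compatible u) (c : ℝ) :
    D.Compatible (c • u) := by
  cases D with
  | neumann Ω => trivial
  | periodic L => exact fun x i => by simp only [Pi.smul_apply, hu x i]

theorem SpatialDomain.compatible_const (c : ℝ) : D.Compatible fun _ => c := by
  cases D with
  | neumann Ω => trivial
  | periodic L => exact fun x i => rfl

section H1

variable {u v : Plane → ℝ}

theorem grad_ae_eq (hD : D.Admissible) {g : Plane → Plane} (hg : HasWeakGrad D.ambient u g) :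
    grad D u =ᵐ[vol D] g := by
  have hex : ∃ g, HasWeakGrad D.ambient u g := ⟨g, hg⟩
  have h1 : HasWeakGrad D.ambient u (grad D u) := by
    rw [grad, weakGrad, dif_pos hex]
    exact hex.choose_spec
  filter_upwards [ae_restrict_of_ae (h1.unique hD.isOpen_ambient hg),
    ae_restrict_mem hD.isOpen_region.measurableSet] with x hx hxU
  exact hx (D.region_subset_ambient hxU)

theorem InH1.add (hD : D.Admissible) (hu : InH1 D u) (hv : InH1 D v) : InH1 D (u + v) := by
  obtain ⟨g, hg, hg2⟩ := hu.2.2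
  obtain ⟨h, hh, hh2⟩ := hv.2.2
  exact ⟨hu.1.add hv.1, hu.2.1.add hv.2.1, g + h, hg.add hD.isOpen_ambient hh, hg2.add hh2⟩

theorem InH1.const_smul (hu : InH1 D u) (c : ℝ) : InH1 D (c • u) := by
  obtain ⟨g, hg, hg2⟩ := hu.2.2
  exact ⟨hu.1.const_smul c, hu.2.1.const_smul c, c • g, hg.const_smul c, hg2.const_smul c⟩

theorem inH1_const (hD : D.Admissible) (c : ℝ) : InH1 D fun _ => c :=
  have := hD.isFiniteMeasure_vol
  ⟨SpatialDomain.compatible_const c, memLp_const c, 0, hasWeakGrad_const c, MemLp.zero⟩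

theorem InH1.sub (hD : D.Admissible) (hu : InH1 D u) (hv : InH1 D v) : InH1 D (u - v) := by
  have := hu.add hD (hv.const_smul (-1))
  rwa [neg_one_smul, ← sub_eq_add_neg] at this

theorem grad_add (hD : D.Admissible) (hu : InH1 D u) (hv : InH1 D v) :
    grad D (u + v) =ᵐ[vol D] grad D u + grad D v := by
  obtain ⟨g, hg, -⟩ := hu.2.2
  obtain ⟨h, hh, -⟩ := hv.2.2
  exact (grad_ae_eq hD (hg.add hD.isOpen_ambient hh)).trans
    ((grad_ae_eq hD hg).add (grad_ae_eq hD hh)).symm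

theorem grad_const_smul (hD : D.Admissible) (hu : InH1 D u) (c : ℝ) :
    grad D (c • u) =ᵐ[vol D] c • grad D u := by
  obtain ⟨g, hg, -⟩ := hu.2.2
  exact (grad_ae_eq hD (hg.const_smul c)).trans ((grad_ae_eq hD hg).const_smul c).symm

theorem InH1.memLp_grad (hD : D.Admissible) (hu : InH1 D u) : MemLp (grad D u) 2 (vol D) := by
  obtain ⟨g, hg, hg2⟩ := hu.2.2
  exact hg2.ae_eq (grad_ae_eq hD hg).symm

theorem InH1.integrable_inner_grad (hD : D.Admissible) (hu : InH1 D u) (hv : InH1 D v) :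
    Integrable (fun x => inner ℝ (grad D u x) (grad D v x)) (vol D) := by
  have h1 := hu.memLp_grad hD
  have h2 := hv.memLp_grad hD
  refine (L2.integrable_inner (𝕜 := ℝ) (h1.toLp _) (h2.toLp _)).congr ?_
  filter_upwards [h1.coeFn_toLp, h2.coeFn_toLp] with x e1 e2
  rw [e1, e2]

theorem dirichlet_comm (u v : Plane → ℝ) : dirichlet D u v = dirichlet D v u := by
  simp only [dirichlet, real_inner_comm]

theorem dirichlet_add_left (hD : D.Admissible) {w : Plane → ℝ} (hu : InH1 D u) (hv : InH1 D v)
    (hw : InH1 D w) :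
    dirichlet D (u + v) w = dirichlet D u w + dirichlet D v w := by
  simp only [dirichlet]
  rw [← integral_add (hu.integrable_inner_grad hD hw) (hv.integrable_inner_grad hD hw)]
  refine integral_congr_ae ?_
  filter_upwards [grad_add hD hu hv] with x hx
  rw [hx, Pi.add_apply, inner_add_left]

theorem dirichlet_smul_left (hD : D.Admissible) (hu : InH1 D u) (c : ℝ) :
    dirichlet D (c • u) v = c * dirichlet D u v := by
  simp only [dirichlet]
  rw [← integral_const_mul]
  refine integral_congr_ae ?_
  filter_upwards [grad_const_smul hD hu c] with x hx
  rw [hx, Pi.smul_apply, real_inner_smul_left]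

theorem dirichlet_const_left (hD : D.Admissible) (c : ℝ) : dirichlet D (fun _ => c) v = 0 := by
  rw [dirichlet, ← integral_zero]
  refine integral_congr_ae ?_
  filter_upwards [grad_ae_eq hD (hasWeakGrad_const (U := D.ambient) c)] with x hx
  rw [hx, Pi.zero_apply, inner_zero_left]

theorem dirichlet_self_nonneg (u : Plane → ℝ) : 0 ≤ dirichlet D u u :=
  integral_nonneg fun _ => real_inner_self_nonneg

/-- The square of a combination in the Dirichlet form. -/
theorem dirichlet_add_smul_self (hD : D.Admissible) (hu : InH1 D u) (hv : InH1 D v) (c : ℝ) :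
    dirichlet D (u + c • v) (u + c • v)
      = dirichlet D u u + 2 * c * dirichlet D u v + c ^ 2 * dirichlet D v v := by
  have hc := hv.const_smul c
  have hs := hu.add hD hc
  rw [dirichlet_add_left hD hu hc hs, dirichlet_smul_left hD hv, dirichlet_comm u,
    dirichlet_comm v, dirichlet_add_left hD hu hc hu, dirichlet_add_left hD hu hc hv,
    dirichlet_smul_left hD hv, dirichlet_smul_left hD hv, dirichlet_comm v u]
  ring

/-- Young's inequality for the Dirichlet form. -/
theorem two_mul_dirichlet_le (hD : D.Admissible) (hu : InH1 D u) (hv : InH1 D v) {l : ℝ}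
    (hl : 0 < l) :
    2 * dirichlet D u v ≤ l * dirichlet D u u + dirichlet D v v / l := by
  have h := dirichlet_self_nonneg (D := D) (u + (-1 / l) • v)
  rw [dirichlet_add_smul_self hD hu hv] at h
  have := mul_nonneg hl.le h
  have e : l * (dirichlet D u u + 2 * (-1 / l) * dirichlet D u v + (-1 / l) ^ 2 * dirichlet D v v)
      = l * dirichlet D u u - 2 * dirichlet D u v + dirichlet D v v / l := by
    field_simp
    ring
  rw [e] at this
  linarith

/-! ### The inverse Laplacian and the negative norm -/

theorem IsInvNegLaplacian.add (hD : D.Admissible) {w z : Plane → ℝ} (h : IsInvNegLaplacian D u w)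
    (h' : IsInvNegLaplacian D v z) : IsInvNegLaplacian D (u + v) (w + z) := by
  have := hD.isFiniteMeasure_vol
  refine ⟨h.1.add h'.1, h.2.1.add hD h'.2.1, ?_, fun ψ hψ => ?_⟩
  · simp only [Pi.add_apply]
    rw [integral_add (h.2.1.2.1.integrable one_le_two) (h'.2.1.2.1.integrable one_le_two),
      h.2.2.1, h'.2.2.1, add_zero]
  · rw [dirichlet_add_left hD h.2.1 h'.2.1 hψ, h.2.2.2 ψ hψ, h'.2.2.2 ψ hψ]
    simp only [Pi.add_apply, add_mul]
    exact (integral_add (h.1.integrable_mul hψ.2.1) (h'.1.integrable_mul hψ.2.1)).symm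

theorem IsInvNegLaplacian.const_smul (hD : D.Admissible) {w : Plane → ℝ}
    (h : IsInvNegLaplacian D u w) (c : ℝ) :
    IsInvNegLaplacian D (c • u) (c • w) := by
  refine ⟨h.1.const_smul c, h.2.1.const_smul c, ?_, fun ψ hψ => ?_⟩
  · simp only [Pi.smul_apply, smul_eq_mul]
    rw [integral_const_mul, h.2.2.1, mul_zero]
  · rw [dirichlet_smul_left hD h.2.1, h.2.2.2 ψ hψ]
    simp only [Pi.smul_apply, smul_eq_mul, mul_assoc]
    rw [integral_const_mul]

theorem isInvNegLaplacian_zero (hD : D.Admissible) : IsInvNegLaplacian D 0 0 := by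
  refine ⟨MemLp.zero, inH1_const hD 0, by simp, fun ψ _ => ?_⟩
  rw [show (0 : Plane → ℝ) = fun _ => 0 from rfl, dirichlet_const_left hD]
  simp

theorem IsInvNegLaplacian.sum (hD : D.Admissible) {ι : Type*} {s : Finset ι} {f g : ι → Plane → ℝ}
    (h : ∀ i ∈ s, IsInvNegLaplacian D (f i) (g i)) :
    IsInvNegLaplacian D (∑ i ∈ s, f i) (∑ i ∈ s, g i) := by
  classical
  induction s using Finset.induction_on with
  | empty => simpa using isInvNegLaplacian_zero hD
  | insert i s hi ih =>
    rw [Finset.sum_insert hi, Finset.sum_insert hi]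
    exact (h i (Finset.mem_insert_self i s)).add hD
      (ih fun j hj => h j (Finset.mem_insert_of_mem hj))

theorem IsInvNegLaplacian.integral_eq_zero (hD : D.Admissible) {w : Plane → ℝ}
    (h : IsInvNegLaplacian D u w) :
    ∫ x, u x ∂(vol D) = 0 := by
  have := h.2.2.2 _ (inH1_const hD 1)
  rw [dirichlet_comm, dirichlet_const_left hD] at this
  simpa using this.symm

/-- `‖v‖_{-1}²` may be computed from any solution of the Poisson problem: two solutions have the
same Dirichlet products with every solution of a Poisson problem. -/
theorem IsInvNegLaplacian.negNorm_sq {w : Plane → ℝ} (h : IsInvNegLaplacian D u w) :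
    negNorm D u ^ 2 = dirichlet D w w := by
  have hex : ∃ w, IsInvNegLaplacian D u w := ⟨w, h⟩
  have h' : IsInvNegLaplacian D u (invNegLaplacian D u) := by
    rw [invNegLaplacian, dif_pos hex]
    exact hex.choose_spec
  have e : negInner D u u = dirichlet D w w := by
    have e1 : negInner D u u = ∫ x, u x * invNegLaplacian D u x ∂(vol D) := by
      simp only [negInner, mul_comm]
    rw [e1, ← h.2.2.2 _ h'.2.1, dirichlet_comm, h'.2.2.2 _ h.2.1, h.2.2.2 _ h.2.1]
  rw [negNorm, e, Real.sq_sqrt (dirichlet_self_nonneg w)]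

theorem negNorm_smul_sq (hD : D.Admissible) {c : ℝ} (hc : c ≠ 0) (v : Plane → ℝ) :
    negNorm D (c • v) ^ 2 = c ^ 2 * negNorm D v ^ 2 := by
  by_cases hex : ∃ w, IsInvNegLaplacian D v w
  · obtain ⟨w, hw⟩ := hex
    rw [(hw.const_smul hD c).negNorm_sq, hw.negNorm_sq, dirichlet_smul_left hD hw.2.1,
      dirichlet_comm, dirichlet_smul_left hD hw.2.1]
    ring
  · have hex' : ¬∃ w, IsInvNegLaplacian D (c • v) w := by
      rintro ⟨w, hw⟩
      have := hw.const_smul hD c⁻¹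
      rw [inv_smul_smul₀ hc] at this
      exact hex ⟨_, this⟩
    -- outside the domain of the inverse Laplacian both sides are zero by convention
    simp [negNorm, negInner, invNegLaplacian, dif_neg hex, dif_neg hex']

/-- A weak equation `v = κ Δ ν` puts `v` in the domain of the inverse Laplacian. -/
theorem exists_isInvNegLaplacian (hD : D.Admissible) {κ : ℝ} {ν : Plane → ℝ}
    (hv : MemLp v 2 (vol D)) (hν : InH1 D ν)
    (h : ∀ ψ, InH1 D ψ → ∫ x, v x * ψ x ∂(vol D) = -(κ * dirichlet D ν ψ)) :
    ∃ w, IsInvNegLaplacian D v w := by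
  have := hD.isFiniteMeasure_vol
  have hs := hν.const_smul (-κ)
  have hc := inH1_const hD (-⨍ a, ((-κ) • ν) a ∂(vol D))
  refine ⟨(-κ) • ν + fun _ => -⨍ a, ((-κ) • ν) a ∂(vol D), hv, hs.add hD hc, ?_, fun ψ hψ => ?_⟩
  · simpa only [Pi.add_apply, ← sub_eq_add_neg] using integral_sub_average (vol D) ((-κ) • ν)
  · rw [dirichlet_add_left hD hs hc hψ, dirichlet_const_left hD, dirichlet_smul_left hD hν, h ψ hψ]
    ring

end H1

/-! ### Discrete convolution inequality -/

theorem sum_Icc_succ_sub (A : ℕ → ℝ) (m : ℕ) :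
    ∑ j ∈ Finset.Icc 1 m, (A (j + 1) - A j) = A (m + 1) - A 1 := by
  induction m with
  | zero => simp
  | succ m ih => rw [Finset.sum_Icc_succ_top (by omega), ih]; ring

/-- Summation by parts. -/
theorem sum_mul_eq_abel (A c : ℕ → ℝ) (m : ℕ) :
    ∑ k ∈ Finset.Icc 1 (m + 1), A k * c k
      = A 1 * ∑ l ∈ Finset.Icc 1 (m + 1), c l
        + ∑ j ∈ Finset.Icc 1 m, (A (j + 1) - A j) * ∑ l ∈ Finset.Icc (j + 1) (m + 1), c l := by
  induction m with
  | zero => simp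
  | succ m ih =>
    have e : ∑ j ∈ Finset.Icc 1 m, (A (j + 1) - A j) * ∑ l ∈ Finset.Icc (j + 1) (m + 1 + 1), c l
        = ∑ j ∈ Finset.Icc 1 m, (A (j + 1) - A j) * ∑ l ∈ Finset.Icc (j + 1) (m + 1), c l
          + (A (m + 1) - A 1) * c (m + 1 + 1) := by
      rw [← sum_Icc_succ_sub, Finset.sum_mul, ← Finset.sum_add_distrib]
      refine Finset.sum_congr rfl fun j hj => ?_
      rw [Finset.mem_Icc] at hj
      rw [Finset.sum_Icc_succ_top (by omega)]
      ring
    rw [Finset.sum_Icc_succ_top (b := m + 1) (by omega) (fun k => A k * c k), ih,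
      Finset.sum_Icc_succ_top (b := m + 1) (by omega) c,
      Finset.sum_Icc_succ_top (b := m) (by omega)
        (fun j => (A (j + 1) - A j) * ∑ l ∈ Finset.Icc (j + 1) (m + 1 + 1), c l), e,
      Finset.Icc_self, Finset.sum_singleton]
    ring

/-- The discrete gradient structure of a convolution. `P j` and `P' j` are the squared norms of the
partial sums from `j` to `m + 1` and to `m`, and `c k` the product of the `k`-th term with the last
one; the kernels `A` and `A'` belong to two consecutive time levels. -/
theorem convolution_energy_le (A A' P P' c : ℕ → ℝ) {m : ℕ} (hm : 1 ≤ m)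
    (hP : ∀ j, 1 ≤ j → j ≤ m + 1 →
      P j + c (m + 1) = P' j + 2 * ∑ l ∈ Finset.Icc j (m + 1), c l)
    (hP' : ∀ j, 0 ≤ P' j) (htop : P' (m + 1) = 0) (h1 : A 1 ≤ A' 1)
    (h2 : ∀ j, 1 ≤ j → j < m → A (j + 1) - A j ≤ A' (j + 1) - A' j) :
    (1 / 2 * ∑ j ∈ Finset.Icc 1 m, (A (j + 1) - A j) * P (j + 1) + 1 / 2 * A 1 * P 1)
      - (1 / 2 * ∑ j ∈ Finset.Icc 1 (m - 1), (A' (j + 1) - A' j) * P' (j + 1)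
        + 1 / 2 * A' 1 * P' 1)
      ≤ ∑ k ∈ Finset.Icc 1 (m + 1), A k * c k - 1 / 2 * A (m + 1) * c (m + 1) := by
  have e1 : 2 * ∑ j ∈ Finset.Icc 1 m, (A (j + 1) - A j) * ∑ l ∈ Finset.Icc (j + 1) (m + 1), c l
      = ∑ j ∈ Finset.Icc 1 m, (A (j + 1) - A j) * P (j + 1)
        - ∑ j ∈ Finset.Icc 1 m, (A (j + 1) - A j) * P' (j + 1)
        + (A (m + 1) - A 1) * c (m + 1) := by
    rw [← sum_Icc_succ_sub, Finset.mul_sum, Finset.sum_mul, ← Finset.sum_sub_distrib,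
      ← Finset.sum_add_distrib]
    refine Finset.sum_congr rfl fun j hj => ?_
    rw [Finset.mem_Icc] at hj
    linear_combination (-(A (j + 1) - A j)) * hP (j + 1) (by omega) (by omega)
  have e2 : ∑ j ∈ Finset.Icc 1 m, (A (j + 1) - A j) * P' (j + 1)
      ≤ ∑ j ∈ Finset.Icc 1 (m - 1), (A' (j + 1) - A' j) * P' (j + 1) := by
    obtain ⟨i, rfl⟩ := Nat.exists_eq_add_of_le' hm
    rw [Finset.sum_Icc_succ_top (by omega), htop, mul_zero, add_zero, Nat.add_sub_cancel]
    refine Finset.sum_le_sum fun j hj => ?_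
    rw [Finset.mem_Icc] at hj
    exact mul_le_mul_of_nonneg_right (h2 j hj.1 (by omega)) (hP' _)
  have e3 := mul_le_mul_of_nonneg_right h1 (hP' 1)
  have e4 := hP 1 le_rfl (by omega)
  rw [sum_mul_eq_abel]
  have e5 : 2 * (A 1 * ∑ l ∈ Finset.Icc 1 (m + 1), c l) = A 1 * (P 1 + c (m + 1) - P' 1) := by
    rw [e4]; ring
  linarith

/-- The local part of the FBDF2 formula, tested with the current increment: `a`, `b` are the
squared norms of the current and of the previous increment and `c` is their product. -/
theorem local_energy_le {α G x y τ τ' a b c : ℝ} (h0 : 0 < α) (hG : 0 < G) (hx : 0 < x)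
    (hτ' : 0 < τ') (hτ : τ = x * τ') (hc : ∀ l : ℝ, 0 < l → 2 * c ≤ l * a + b / l) :
    α * y ^ (2 - α / 2) / (2 * (1 + y) * τ ^ α) * (a / G)
      - α * x ^ (2 - α / 2) / (2 * (1 + x) * τ' ^ α) * (b / G)
      + gFun x y α / (2 * G * τ ^ α) * a
      ≤ 1 / (G * τ ^ α) * ((1 + (1 + α) * x) / (1 + x) * a - α * x ^ 2 / (1 + x) * c) := by
  set s := x ^ (α / 2) with hs
  have hs0 : 0 < s := Real.rpow_pos_of_pos hx _
  have hxp : x ^ (2 - α / 2) = x ^ 2 / s := by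
    rw [Real.rpow_sub hx, Real.rpow_two]
  have hxα : x ^ α = s ^ 2 := by
    rw [hs, ← Real.rpow_natCast, ← Real.rpow_mul hx.le]; norm_num
  have hτα : τ ^ α = s ^ 2 * τ' ^ α := by
    rw [hτ, Real.mul_rpow hx.le hτ'.le, hxα]
  have hT : 0 < τ' ^ α := Real.rpow_pos_of_pos hτ' _
  rw [hτα, gFun, hxp]
  generalize y ^ (2 - α / 2) = Y
  set T := τ' ^ α
  have key := hc (1 / s) (by positivity)
  have hk : 0 ≤ α * x ^ 2 / (2 * (1 + x) * (G * (s ^ 2 * T))) := by positivity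
  have := mul_le_mul_of_nonneg_left key hk
  rw [← sub_nonneg] at this ⊢
  refine this.trans_eq ?_
  rw [show α * Y / (2 * (1 + y) * (s ^ 2 * T)) = α * Y / (1 + y) / (2 * (s ^ 2 * T)) by
    rw [div_div]; congr 1; ring]
  generalize α * Y / (1 + y) = Z
  field_simp
  ring

/-! ### The double-well potential -/

/-- The quartic part of the potential is convex; the concave part costs `(a - b)² / 2`. -/
theorem potential_sub_le (a b : ℝ) :
    potential a - potential b ≤ nonlin a * (a - b) + 1 / 2 * (a - b) ^ 2 := by
  have : 0 ≤ 1 / 4 * (a - b) ^ 2 * ((a + b) ^ 2 + 2 * a ^ 2) := by positivity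
  simp only [potential, nonlin]
  linarith

theorem integrable_potential {Ω : Type*} [MeasurableSpace Ω] {μ : Measure Ω} [IsFiniteMeasure μ]
    {u : Ω → ℝ} (hu : MemLp u 2 μ) (hf : MemLp (fun x => nonlin (u x)) 2 μ) :
    Integrable (fun x => potential (u x)) μ := by
  have h1 : Integrable (fun x => nonlin (u x) * u x) μ := hf.integrable_mul hu
  refine ((h1.sub hu.integrable_sq).const_mul (1 / 4) |>.add (integrable_const (1 / 4))).congr
    (Eventually.of_forall fun x => ?_)
  simp only [potential, nonlin, Pi.add_apply, Pi.sub_apply]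
  ring

/-! ### Solutions of the scheme -/

section Scheme

variable {D : SpatialDomain} {α ε κ : ℝ} {N : ℕ} {t : ℕ → ℝ} {φ μ : ℕ → Plane → ℝ}

theorem IsFBDF2Solution.memLp (hsol : IsFBDF2Solution D α ε κ t N φ μ) {n : ℕ} (hn : n ≤ N) :
    MemLp (φ n) 2 (vol D) := by
  rcases Nat.eq_zero_or_pos n with rfl | h
  · exact hsol.initial
  · exact (hsol.phi_mem n h hn).2.1

theorem IsFBDF2Solution.memLp_incr (hsol : IsFBDF2Solution D α ε κ t N φ μ) {n : ℕ} (hn : n ≤ N) :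
    MemLp (incr φ n) 2 (vol D) :=
  (hsol.memLp hn).sub (hsol.memLp (by omega))

/-- Every increment of a solution lies in the domain of the inverse Laplacian, by induction on the
time level: the scheme expresses it by `Δ μ^n` and the previous increments. -/
theorem IsFBDF2Solution.exists_isInvNegLaplacian_incr (hsol : IsFBDF2Solution D α ε κ t N φ μ)
    (hD : D.Admissible) (h0 : 0 < α) (h1 : α < 1) (ht : ∀ k, k ≤ N → t k < t (k + 1)) (n : ℕ)
    (hn : 1 ≤ n) (hnN : n ≤ N) : ∃ w, IsInvNegLaplacian D (incr φ n) w := by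
  induction n using Nat.strong_induction_on with
  | _ n ih =>
    obtain ⟨b, c, hb, hbc⟩ := exists_fbdf2_eq_sum h0 h1 ht hn hnN
    set V : Plane → ℝ := fun x => fbdf2 α t (fun k => φ k x) n with hV
    set S : Plane → ℝ := ∑ k ∈ Finset.Icc 1 (n - 1), c k • incr φ k with hS
    have hVS : V = b • incr φ n + S := by
      funext x
      simp only [hV, hS, hbc, Pi.add_apply, Pi.smul_apply, Finset.sum_apply, smul_eq_mul, incr]
    choose! w hw using fun k (hk : k ∈ Finset.Icc 1 (n - 1)) => ih k
      (by rw [Finset.mem_Icc] at hk; omega) (Finset.mem_Icc.mp hk).1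
      (by rw [Finset.mem_Icc] at hk; omega)
    have hSw := IsInvNegLaplacian.sum hD fun k hk => (hw k hk).const_smul hD (c k)
    have hVm : MemLp V 2 (vol D) := by
      rw [hVS]
      exact ((hsol.memLp_incr hnN).const_smul b).add hSw.1
    obtain ⟨W, hW⟩ := exists_isInvNegLaplacian hD hVm (hsol.mu_mem n hn hnN)
      (hsol.evolution n hn hnN)
    have := (hW.add hD (hSw.const_smul hD (-1))).const_smul hD b⁻¹
    have e : b⁻¹ • (V + (-1 : ℝ) • S) = incr φ n := by
      rw [hVS, neg_one_smul, add_neg_cancel_right, inv_smul_smul₀ hb.ne']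
    exact ⟨_, e ▸ this⟩

theorem freeEnergy_eq (u : Plane → ℝ) :
    freeEnergy D ε u = ε ^ 2 / 2 * dirichlet D u u + ∫ x, potential (u x) ∂(vol D) := by
  simp only [freeEnergy, dirichlet, real_inner_self_eq_norm_sq]

/-- Testing the scheme with `(-Δ)⁻¹` of the increment. -/
theorem IsFBDF2Solution.freeEnergy_sub_le (hsol : IsFBDF2Solution D α ε κ t N φ μ)
    (hD : D.Admissible) (hε : 0 < ε) (hκ : 0 < κ) {m : ℕ} (hm : 1 ≤ m) (hmN : m + 1 ≤ N)
    {w : Plane → ℝ} (hw : IsInvNegLaplacian D (incr φ (m + 1)) w) :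
    freeEnergy D ε (φ (m + 1)) - freeEnergy D ε (φ m)
      + 1 / κ * ∫ x, fbdf2 α t (fun k => φ k x) (m + 1) * w x ∂(vol D)
      ≤ 1 / (8 * ε ^ 2) * dirichlet D w w := by
  have := hD.isFiniteMeasure_vol
  have hφn := hsol.phi_mem (m + 1) (by omega) hmN
  have hφm := hsol.phi_mem m hm (by omega)
  have hfn := hsol.nonlin_mem (m + 1) (by omega) hmN
  have hfm := hsol.nonlin_mem m hm (by omega)
  have hμ := hsol.mu_mem (m + 1) (by omega) hmN
  set v := incr φ (m + 1) with hv
  have hvsub : v = φ (m + 1) - φ m := rfl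
  have hvH : InH1 D v := hφn.sub hD hφm
  have e1 := hsol.evolution (m + 1) (by omega) hmN w hw.2.1
  have e2 := hsol.potential_eq (m + 1) (by omega) hmN v hvH
  have e3 := hw.2.2.2 _ hμ
  rw [dirichlet_comm] at e3
  have e4 : ∫ x, v x * μ (m + 1) x ∂(vol D) = ∫ x, μ (m + 1) x * v x ∂(vol D) := by
    simp only [mul_comm]
  have e5 : 1 / κ * ∫ x, fbdf2 α t (fun k => φ k x) (m + 1) * w x ∂(vol D)
      = -(∫ x, nonlin (φ (m + 1) x) * v x ∂(vol D) + ε ^ 2 * dirichlet D (φ (m + 1)) v) := by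
    rw [e1, e3, e4, e2]
    field_simp
  have e6 : 2 * dirichlet D (φ (m + 1)) v
      = dirichlet D (φ (m + 1)) (φ (m + 1)) - dirichlet D (φ m) (φ m) + dirichlet D v v := by
    have hdec : φ m = φ (m + 1) + (-1 : ℝ) • v := by
      rw [hvsub, neg_one_smul]; abel
    rw [hdec, dirichlet_add_smul_self hD hφn hvH]
    ring
  have i1 := integrable_potential hφn.2.1 hfn
  have i2 := integrable_potential hφm.2.1 hfm
  have i3 : Integrable (fun x => nonlin (φ (m + 1) x) * v x) (vol D) :=
    hfn.integrable_mul hvH.2.1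
  have i4 : Integrable (fun x => 1 / 2 * v x ^ 2) (vol D) := hvH.2.1.integrable_sq.const_mul _
  have e7 : ∫ x, potential (φ (m + 1) x) ∂(vol D) - ∫ x, potential (φ m x) ∂(vol D)
      ≤ ∫ x, nonlin (φ (m + 1) x) * v x ∂(vol D) + 1 / 2 * ∫ x, v x ^ 2 ∂(vol D) := by
    rw [← integral_sub i1 i2, ← integral_const_mul, ← integral_add i3 i4]
    exact integral_mono (i1.sub i2) (i3.add i4) fun x => potential_sub_le _ _
  have e8 : ∫ x, v x ^ 2 ∂(vol D) = dirichlet D v w := by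
    rw [dirichlet_comm, hw.2.2.2 v hvH]
    simp only [sq]
  have e9 := two_mul_dirichlet_le hD hvH hw.2.1 (l := 2 * ε ^ 2) (by positivity)
  rw [freeEnergy_eq, freeEnergy_eq, e5]
  rw [e8] at e7
  have e10 : dirichlet D w w / (2 * ε ^ 2) = 4 * (1 / (8 * ε ^ 2) * dirichlet D w w) := by
    field_simp
    ring
  rw [e10] at e9
  have e11 : ε ^ 2 * dirichlet D (φ (m + 1)) v = ε ^ 2 / 2 * (2 * dirichlet D (φ (m + 1)) v) := by
    ring
  rw [e11, e6]
  linarith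

/-- The scheme tested with `(-Δ)⁻¹` of the current increment, in terms of the Dirichlet products of
the functions `w k = (-Δ)⁻¹ (φ^k - φ^(k-1))`. -/
theorem integral_fbdf2_mul_eq (h0 : 0 < α) (h1 : α < 1) (ht : ∀ k, k ≤ N → t k < t (k + 1)) {m : ℕ}
    (hm : 1 ≤ m) (hmN : m + 1 ≤ N) {w : ℕ → Plane → ℝ}
    (hw : ∀ k, 1 ≤ k → k ≤ N → IsInvNegLaplacian D (incr φ k) (w k)) :
    ∫ x, fbdf2 α t (fun k => φ k x) (m + 1) * w (m + 1) x ∂(vol D)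
      = 1 / (Real.Gamma (3 - α) * step t (m + 1) ^ α)
          * ((1 + (1 + α) * ratio t (m + 1)) / (1 + ratio t (m + 1))
              * dirichlet D (w (m + 1)) (w (m + 1))
            - α * ratio t (m + 1) ^ 2 / (1 + ratio t (m + 1)) * dirichlet D (w m) (w (m + 1)))
        + ∑ k ∈ Finset.Icc 1 (m + 1), kerHat α t (m + 1) k * dirichlet D (w k) (w (m + 1)) := by
  have hwn := (hw (m + 1) (by omega) hmN).2.1
  have hi : ∀ k, 1 ≤ k → k ≤ N → Integrable (fun x => incr φ k x * w (m + 1) x) (vol D) :=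
    fun k hk hkN => (hw k hk hkN).1.integrable_mul hwn.2.1
  have hd : ∀ k, 1 ≤ k → k ≤ N →
      dirichlet D (w k) (w (m + 1)) = ∫ x, incr φ k x * w (m + 1) x ∂(vol D) :=
    fun k hk hkN => (hw k hk hkN).2.2.2 _ hwn
  set g := 1 / (Real.Gamma (3 - α) * step t (m + 1) ^ α)
  set p := (1 + (1 + α) * ratio t (m + 1)) / (1 + ratio t (m + 1))
  set q := α * ratio t (m + 1) ^ 2 / (1 + ratio t (m + 1))
  have e : ∀ x, fbdf2 α t (fun k => φ k x) (m + 1) * w (m + 1) x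
      = (g * p * (incr φ (m + 1) x * w (m + 1) x) - g * q * (incr φ m x * w (m + 1) x))
        + ∑ k ∈ Finset.Icc 1 (m + 1), kerHat α t (m + 1) k * (incr φ k x * w (m + 1) x) := by
    intro x
    rw [fbdf2_succ h0 h1 ht hm (by omega), add_mul, Finset.sum_mul]
    simp only [incr, Nat.add_sub_cancel, mul_assoc]
    ring
  simp only [e]
  have hmem : ∀ k ∈ Finset.Icc 1 (m + 1), 1 ≤ k ∧ k ≤ N := fun k hk => by
    rw [Finset.mem_Icc] at hk; omega
  have I1 := (hi (m + 1) (by omega) hmN).const_mul (g * p)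
  have I2 := (hi m hm (by omega)).const_mul (g * q)
  have I3 : ∀ k ∈ Finset.Icc 1 (m + 1), Integrable
      (fun x => kerHat α t (m + 1) k * (incr φ k x * w (m + 1) x)) (vol D) :=
    fun k hk => (hi k (hmem k hk).1 (hmem k hk).2).const_mul _
  have I12 : Integrable (fun x => g * p * (incr φ (m + 1) x * w (m + 1) x)
      - g * q * (incr φ m x * w (m + 1) x)) (vol D) := I1.sub I2
  rw [integral_add I12 (integrable_finsetSum _ I3), integral_sub I1 I2,
    integral_finsetSum _ I3, integral_const_mul, integral_const_mul,
    ← hd (m + 1) (by omega) hmN, ← hd m hm (by omega)]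
  congr 1
  · ring
  · refine Finset.sum_congr rfl fun k hk => ?_
    rw [integral_const_mul, hd k (hmem k hk).1 (hmem k hk).2]

theorem inH1_sum (hD : D.Admissible) {s : Finset ℕ} {w : ℕ → Plane → ℝ}
    (h : ∀ k ∈ s, InH1 D (w k)) : InH1 D (∑ k ∈ s, w k) := by
  classical
  induction s using Finset.induction_on with
  | empty => exact inH1_const hD 0
  | insert i s hi ih =>
    rw [Finset.sum_insert hi]
    exact (h i (Finset.mem_insert_self i s)).add hD
      (ih fun j hj => h j (Finset.mem_insert_of_mem hj))

theorem dirichlet_sum_left (hD : D.Admissible) {s : Finset ℕ} {w : ℕ → Plane → ℝ} {v : Plane → ℝ}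
    (h : ∀ k ∈ s, InH1 D (w k)) (hv : InH1 D v) :
    dirichlet D (∑ k ∈ s, w k) v = ∑ k ∈ s, dirichlet D (w k) v := by
  classical
  induction s using Finset.induction_on with
  | empty => exact dirichlet_const_left hD 0
  | insert i s hi ih =>
    have hs : ∀ k ∈ s, InH1 D (w k) := fun j hj => h j (Finset.mem_insert_of_mem hj)
    rw [Finset.sum_insert hi, Finset.sum_insert hi,
      dirichlet_add_left hD (h i (Finset.mem_insert_self i s)) (inH1_sum hD hs) hv, ih hs]

/-- The energy of the memory term grows by at most the work of the fractional derivative, up to the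
dissipation `g(r_n, r_{n+1}, α) / (2 Γ(3-α) τ_n^α) ‖∇_τ φ^n‖_{-1}²`. -/
theorem gEnergy_sub_le (hD : D.Admissible) (h0 : 0 < α) (h1 : α < 1)
    (ht : ∀ k, k ≤ N → t k < t (k + 1))
    (hr : ∀ k, 2 ≤ k → k ≤ N + 1 → ratioLower ≤ ratio t k) {m : ℕ}
    (hm : 1 ≤ m) (hmN : m + 1 ≤ N) {w : ℕ → Plane → ℝ}
    (hw : ∀ k, 1 ≤ k → k ≤ N → IsInvNegLaplacian D (incr φ k) (w k)) :
    gEnergy D α t (incr φ) (m + 1) - gEnergy D α t (incr φ) m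
      + gFun (ratio t (m + 1)) (ratio t (m + 2)) α
        / (2 * Real.Gamma (3 - α) * step t (m + 1) ^ α) * dirichlet D (w (m + 1)) (w (m + 1))
      ≤ ∫ x, fbdf2 α t (fun k => φ k x) (m + 1) * w (m + 1) x ∂(vol D) := by
  set Q : ℕ → ℕ → ℝ := fun n j =>
    dirichlet D (∑ l ∈ Finset.Icc j n, w l) (∑ l ∈ Finset.Icc j n, w l) with hQ
  have hnorm : ∀ n j, 1 ≤ j → n ≤ N →
      negNorm D (fun x => ∑ l ∈ Finset.Icc j n, incr φ l x) ^ 2 = Q n j := by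
    intro n j hj hn
    have e : (fun x => ∑ l ∈ Finset.Icc j n, incr φ l x) = ∑ l ∈ Finset.Icc j n, incr φ l := by
      funext x; rw [Finset.sum_apply]
    rw [e]
    refine (IsInvNegLaplacian.sum hD fun l hl => ?_).negNorm_sq
    rw [Finset.mem_Icc] at hl
    exact hw l (by omega) (by omega)
  have hwH : ∀ k, 1 ≤ k → k ≤ N → InH1 D (w k) := fun k hk hkN => (hw k hk hkN).2.1
  have hn := hwH (m + 1) (by omega) hmN
  have hG : 0 < Real.Gamma (3 - α) := Real.Gamma_pos_of_pos (by linarith)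
  have hloc := local_energy_le (y := ratio t (m + 2)) h0 hG
    (ratio_succ_pos ht hm (by omega)) (step_pos ht hm (by omega))
    (show step t (m + 1) = ratio t (m + 1) * step t m by
      have := (step_pos ht hm (by omega)).ne'
      rw [ratio_succ hm]; field_simp)
    (fun l hl => by
      have := two_mul_dirichlet_le hD hn (hwH m hm (by omega)) hl
      rwa [dirichlet_comm (w (m + 1)) (w m)] at this)
  have hconv := convolution_energy_le (kerMod α t (m + 1)) (kerMod α t m) (Q (m + 1)) (Q m)
    (fun k => dirichlet D (w k) (w (m + 1))) hm
    (fun j hj hjm => by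
      have hS : InH1 D (∑ l ∈ Finset.Icc j m, w l) := inH1_sum hD fun l hl => by
        rw [Finset.mem_Icc] at hl; exact hwH l (by omega) (by omega)
      have e := dirichlet_add_smul_self hD hS hn 1
      rw [one_smul, dirichlet_sum_left hD (fun l hl => by
        rw [Finset.mem_Icc] at hl; exact hwH l (by omega) (by omega)) hn] at e
      simp only [hQ]
      rw [Finset.sum_Icc_succ_top (by omega), Finset.sum_Icc_succ_top (by omega), e]
      ring)
    (fun j => dirichlet_self_nonneg _)
    (by
      simp only [hQ]
      rw [Finset.Icc_eq_empty (by omega), Finset.sum_empty]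
      exact dirichlet_const_left hD 0)
    (kerMod_succ_one_le h0 h1 ht hm (by omega))
    (fun j hj hjm => kerMod_succ_sub_le h0 h1 ht hr hj hjm (by omega))
  rw [integral_fbdf2_mul_eq h0 h1 ht hm hmN hw]
  have hhat : ∑ k ∈ Finset.Icc 1 (m + 1), kerMod α t (m + 1) k * dirichlet D (w k) (w (m + 1))
        - 1 / 2 * kerMod α t (m + 1) (m + 1) * dirichlet D (w (m + 1)) (w (m + 1))
      = ∑ k ∈ Finset.Icc 1 (m + 1), kerHat α t (m + 1) k * dirichlet D (w k) (w (m + 1)) := by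
    rw [Finset.sum_Icc_succ_top (by omega), Finset.sum_Icc_succ_top (by omega)]
    have e : ∀ k ∈ Finset.Icc 1 m, kerMod α t (m + 1) k * dirichlet D (w k) (w (m + 1))
        = kerHat α t (m + 1) k * dirichlet D (w k) (w (m + 1)) := fun k hk => by
      rw [Finset.mem_Icc] at hk
      rw [kerMod, if_neg (by omega)]
    rw [Finset.sum_congr rfl e, kerMod, if_pos rfl]
    ring
  rw [hhat] at hconv
  have hE : ∀ n, 1 ≤ n → n ≤ N → gEnergy D α t (incr φ) n
      = α * ratio t (n + 1) ^ (2 - α / 2) / (2 * (1 + ratio t (n + 1)) * step t n ^ α)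
          * (dirichlet D (w n) (w n) / Real.Gamma (3 - α))
        + (1 / 2 * ∑ j ∈ Finset.Icc 1 (n - 1), (kerMod α t n (j + 1) - kerMod α t n j) * Q n (j + 1)
          + 1 / 2 * kerMod α t n 1 * Q n 1) := by
    intro n hn1 hnN
    rw [gEnergy, (hw n hn1 hnN).negNorm_sq, hnorm n 1 le_rfl hnN, add_assoc]
    simp only [hnorm n _ (Nat.succ_le_succ (Nat.zero_le _)) hnN]
  rw [hE (m + 1) (by omega) hmN, hE m hm (by omega), Nat.add_sub_cancel]
  linarith

/-- The step-size restriction makes the dissipation dominate the concave part of the potential. -/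
theorem le_gFun_div_of_step_le {τ g G : ℝ} (h0 : 0 < α) (hε : 0 < ε) (hκ : 0 < κ) (hτ : 0 < τ)
    (hG : 0 < G) (hg : 0 ≤ g) (h : τ ≤ (4 * ε ^ 2 / κ * (g / G)) ^ (1 / α)) :
    1 / (8 * ε ^ 2) ≤ 1 / κ * (g / (2 * G * τ ^ α)) := by
  have hB : 0 ≤ 4 * ε ^ 2 / κ * (g / G) := by positivity
  have h2 : τ ^ α ≤ 4 * ε ^ 2 / κ * (g / G) := by
    have := Real.rpow_le_rpow hτ.le h h0.le
    rwa [← Real.rpow_mul hB, one_div_mul_cancel h0.ne', Real.rpow_one] at this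
  have hT : 0 < τ ^ α := Real.rpow_pos_of_pos hτ _
  have h3 : τ ^ α * (κ * G) ≤ 4 * ε ^ 2 * g := by
    have := mul_le_mul_of_nonneg_right h2 (mul_pos hκ hG).le
    have e : 4 * ε ^ 2 / κ * (g / G) * (κ * G) = 4 * ε ^ 2 * g := by field_simp
    rwa [e] at this
  rw [div_mul_div_comm, one_mul, div_le_div_iff₀ (by positivity) (by positivity)]
  linarith

/-- One step of the dissipation law. -/
theorem IsFBDF2Solution.modEnergy_succ_le (hsol : IsFBDF2Solution D α ε κ t N φ μ)
    (hD : D.Admissible) (h0 : 0 < α) (h1 : α < 1) (hε : 0 < ε) (hκ : 0 < κ)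
    (ht : ∀ k, k ≤ N → t k < t (k + 1))
    (hr : ∀ k, 2 ≤ k → k ≤ N + 1 → ratioLower ≤ ratio t k ∧ ratio t k < ratioUpper α) {m : ℕ}
    (hm : 1 ≤ m) (hmN : m + 1 ≤ N)
    (hstep : step t (m + 1) ≤ (4 * ε ^ 2 / κ * (gFun (ratio t (m + 1)) (ratio t (m + 2)) α
      / Real.Gamma (3 - α))) ^ (1 / α)) :
    modEnergy D α ε κ t φ (m + 1) ≤ modEnergy D α ε κ t φ m := by
  choose! w hw using hsol.exists_isInvNegLaplacian_incr hD h0 h1 ht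
  have hG : 0 < Real.Gamma (3 - α) := Real.Gamma_pos_of_pos (by linarith)
  have hg := gFun_nonneg h0 h1 (ratio_pos ht (k := m + 1) (by omega) (by omega))
    (hr (m + 1) (by omega) (by omega)).2 (ratio_pos ht (k := m + 2) (by omega) (by omega))
    (hr (m + 2) (by omega) (by omega)).2
  have e1 := hsol.freeEnergy_sub_le hD hε hκ hm hmN (hw (m + 1) (by omega) hmN)
  have e2 := gEnergy_sub_le hD h0 h1 ht (fun k h h' => (hr k h h').1) hm hmN hw
  have e3 := mul_le_mul_of_nonneg_right (le_gFun_div_of_step_le h0 hε hκ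
    (step_pos ht (k := m + 1) (by omega) (by omega)) hG hg hstep)
    (dirichlet_self_nonneg (D := D) (w (m + 1)))
  have e4 := mul_le_mul_of_nonneg_left e2 (one_div_pos.mpr hκ).le
  rw [modEnergy, modEnergy]
  linarith

end Scheme

/-! ### Compatibility with the BDF2 energy -/

/-- All memory kernels vanish in the limit, so only the local term of `𝒢` survives. The identity
`r^(3/2) / τ_n = √r τ_{n+1} / τ_n²` turns it into the BDF2 term. -/
theorem tendsto_modEnergy {D : SpatialDomain} (hD : D.Admissible) (ε κ : ℝ) {N : ℕ} {t : ℕ → ℝ}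
    (ht : ∀ k, k ≤ N → t k < t (k + 1)) {n : ℕ} (hn : 2 ≤ n) (hnN : n ≤ N)
    (ψ : ℕ → Plane → ℝ) :
    Tendsto (fun β : ℝ => modEnergy D β ε κ t ψ n) (𝓝[<] 1) (𝓝 (bdf2Energy D ε κ t ψ n)) := by
  have hτ := step_pos ht (k := n) (by omega) (by omega)
  have hr := ratio_succ_pos ht (k := n) (by omega) hnN
  have hker : ∀ k, 1 ≤ k → k ≤ n → Tendsto (fun β => kerMod β t n k) (𝓝[<] 1) (𝓝 0) :=
    fun k hk hkn => tendsto_kerMod ht (by omega) hk hkn (by omega)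
  set r := ratio t (n + 1) with hrdef
  set τ := step t n with hτdef
  have hG : ContinuousAt Real.Gamma (3 - 1) := by
    refine (Real.differentiableAt_Gamma fun m => ?_).continuousAt
    have : (0 : ℝ) ≤ m := m.cast_nonneg
    linarith
  have hlocal : Tendsto (fun β : ℝ => β * r ^ (2 - β / 2) / (2 * (1 + r) * τ ^ β)
      * (negNorm D (incr ψ n) ^ 2 / Real.Gamma (3 - β))) (𝓝[<] 1)
      (𝓝 (1 * r ^ (2 - 1 / 2 : ℝ) / (2 * (1 + r) * τ ^ (1 : ℝ))
        * (negNorm D (incr ψ n) ^ 2 / Real.Gamma (3 - 1)))) := by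
    refine tendsto_nhdsWithin_of_tendsto_nhds (ContinuousAt.tendsto (f := fun β : ℝ =>
      β * r ^ (2 - β / 2) / (2 * (1 + r) * τ ^ β)
      * (negNorm D (incr ψ n) ^ 2 / Real.Gamma (3 - β))) ?_)
    have c1 : ContinuousAt (fun β : ℝ => r ^ (2 - β / 2)) 1 :=
      continuousAt_const.rpow (by fun_prop) (Or.inl hr.ne')
    have c2 : ContinuousAt (fun β : ℝ => τ ^ β) 1 :=
      continuousAt_const.rpow (by fun_prop) (Or.inl hτ.ne')
    have c3 : ContinuousAt (fun β : ℝ => Real.Gamma (3 - β)) 1 :=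
      ContinuousAt.comp (f := fun β : ℝ => 3 - β) hG (by fun_prop)
    refine ((continuousAt_id.mul c1).div (continuousAt_const.mul c2) ?_).mul
      (continuousAt_const.div c3 (Real.Gamma_pos_of_pos (by norm_num)).ne')
    exact (by positivity : 2 * (1 + r) * τ ^ (1 : ℝ) ≠ 0)
  have hsum : Tendsto (fun β : ℝ => ∑ j ∈ Finset.Icc 1 (n - 1),
      (kerMod β t n (j + 1) - kerMod β t n j)
        * negNorm D (fun x => ∑ l ∈ Finset.Icc (j + 1) n, incr ψ l x) ^ 2) (𝓝[<] 1)
      (𝓝 (∑ j ∈ Finset.Icc 1 (n - 1), (0 - 0)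
        * negNorm D (fun x => ∑ l ∈ Finset.Icc (j + 1) n, incr ψ l x) ^ 2)) := by
    refine tendsto_finsetSum _ fun j hj => ?_
    rw [Finset.mem_Icc] at hj
    exact ((hker (j + 1) (by omega) (by omega)).sub (hker j hj.1 (by omega))).mul_const _
  have hall := (((hlocal.add (hsum.const_mul (1 / 2))).add
    (((hker 1 le_rfl (by omega)).const_mul (1 / 2)).mul_const
      (negNorm D (fun x => ∑ l ∈ Finset.Icc 1 n, incr ψ l x) ^ 2))).const_mul (1 / κ)).const_add
    (freeEnergy D ε (ψ n))
  have hval : bdf2Energy D ε κ t ψ n = freeEnergy D ε (ψ n) + 1 / κ *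
      (1 * r ^ (2 - 1 / 2 : ℝ) / (2 * (1 + r) * τ ^ (1 : ℝ))
        * (negNorm D (incr ψ n) ^ 2 / Real.Gamma (3 - 1))
      + 1 / 2 * ∑ j ∈ Finset.Icc 1 (n - 1), (0 - 0)
        * negNorm D (fun x => ∑ l ∈ Finset.Icc (j + 1) n, incr ψ l x) ^ 2
      + 1 / 2 * 0 * negNorm D (fun x => ∑ l ∈ Finset.Icc 1 n, incr ψ l x) ^ 2) := by
    have e1 : (fun x => incr ψ n x / τ) = τ⁻¹ • incr ψ n := by
      funext x
      simp only [Pi.smul_apply, smul_eq_mul]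
      ring
    have e2 : r ^ (2 - 1 / 2 : ℝ) = r * √r := by
      rw [show (2 - 1 / 2 : ℝ) = 1 + 1 / 2 by norm_num, Real.rpow_add hr, Real.rpow_one,
        ← Real.sqrt_eq_rpow]
    have e3 : Real.Gamma (3 - 1) = 1 := by norm_num [Real.Gamma_two]
    have e4 : step t (n + 1) = r * τ := by
      rw [hrdef, ratio_succ (by omega)]
      exact (div_mul_cancel₀ _ hτ.ne').symm
    rw [bdf2Energy, ← hrdef, ← hτdef, e1, negNorm_smul_sq hD (inv_ne_zero hτ.ne'), e2, e3, e4,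
      Real.rpow_one]
    simp only [sub_zero, zero_mul, Finset.sum_const_zero, mul_zero, add_zero]
    field_simp
  rw [hval]
  exact hall

end TFCH

theorem theorem3p2
    (D : TFCH.SpatialDomain) (hD : D.Admissible)
    (α ε κ : ℝ) (hα0 : 0 < α) (hα1 : α < 1) (hε : 0 < ε) (hκ : 0 < κ)
    (N : ℕ) (t : ℕ → ℝ) (ht0 : t 0 = 0) (ht : ∀ k, k ≤ N → t k < t (k + 1))
    (hratio : ∀ k, 2 ≤ k → k ≤ N + 1 →
      TFCH.ratioLower ≤ TFCH.ratio t k ∧ TFCH.ratio t k < TFCH.ratioUpper α)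
    (hstep : ∀ n, 2 ≤ n → n ≤ N →
      TFCH.step t n ≤
        (4 * ε ^ 2 / κ * (TFCH.gFun (TFCH.ratio t n) (TFCH.ratio t (n + 1)) α
          / Real.Gamma (3 - α))) ^ (1 / α))
    (φ μ : ℕ → TFCH.Plane → ℝ)
    (hsol : TFCH.IsFBDF2Solution D α ε κ t N φ μ) :
    -- the energies are well defined: `F(φ^n)` is integrable and `∇_τ φ^n` is a zero-mean
    -- function in the domain of `(-Δ)⁻¹`
    (∀ n, 1 ≤ n → n ≤ N →
      Integrable (fun x => TFCH.potential (φ n x)) (TFCH.vol D) ∧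
      ∫ x, TFCH.incr φ n x ∂(TFCH.vol D) = 0 ∧
      ∃ w, TFCH.IsInvNegLaplacian D (TFCH.incr φ n) w) ∧
    -- energy dissipation: `∂_τ ℰ_α[φ^n] ≤ 0`
    (∀ n, 2 ≤ n → n ≤ N →
      (TFCH.modEnergy D α ε κ t φ n - TFCH.modEnergy D α ε κ t φ (n - 1)) / TFCH.step t n ≤ 0) ∧
    -- asymptotic compatibility of the energy with the BDF2 energy as the order tends to `1⁻`
    (∀ n, 2 ≤ n → n ≤ N → ∀ ψ : ℕ → TFCH.Plane → ℝ,
      Tendsto (fun β : ℝ => TFCH.modEnergy D β ε κ t ψ n) (𝓝[<] 1)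
        (𝓝 (TFCH.bdf2Energy D ε κ t ψ n))) := by
  have := hD.isFiniteMeasure_vol
  refine ⟨fun n hn hnN => ?_, fun n hn hnN => ?_, fun n hn hnN ψ =>
    TFCH.tendsto_modEnergy hD ε κ ht hn hnN ψ⟩
  · obtain ⟨w, hw⟩ := hsol.exists_isInvNegLaplacian_incr hD hα0 hα1 ht n hn hnN
    exact ⟨TFCH.integrable_potential (hsol.phi_mem n hn hnN).2.1 (hsol.nonlin_mem n hn hnN),
      hw.integral_eq_zero hD, w, hw⟩
  · obtain ⟨m, rfl⟩ := Nat.exists_eq_add_of_le' (show 1 ≤ n by omega)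
    have := hsol.modEnergy_succ_le hD hα0 hα1 hε hκ ht hratio (show 1 ≤ m by omega) hnN
      (hstep (m + 1) hn hnN)
    exact div_nonpos_of_nonpos_of_nonneg (sub_nonpos.mpr this)
      (TFCH.step_pos ht (by omega) (by omega)).le
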